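/- Let $X$ be a compact metric space and let $\varphi:\mathbb{R}^+\times X\to X$ be a semi-flow, i.e. a continuous map with $\varphi(0,x)=x$ and $\varphi(s+t,x)=\varphi(s,\varphi(t,x))$ (a flow is regarded as the semi-flow of its nonnegative times). For $Y\subset X$ let $\omega(Y)=\bigcap_{t>0}\mathrm{cl}\,\varphi([t,\infty),Y)$. A set $A\subset X$ is an attractor if $\omega(U)=A$ for some neighborhood $U$ of $A$; its dual repeller is $R=\{x\in X:\omega(x)\cap A=\emptyset\}$, and $(A,R)$ is then called an attractor-repeller pair. A set $S$ is invariant if $\varphi(t,S)=S$ for all $t\ge 0$, and $\mathrm{Inv}(Y)$ is the union of all invariant sets contained in $Y$. An index pair for an invariant set $S$ is a pair of compact sets $L\subset N\subset X$ such that (1) $S=\mathrm{Inv}(\mathrm{cl}(N\setminus L))$ and $N\setminus L$ is a neighborhood of $S$; (2) if $x\in L$ and $\varphi([0,t],x)\subset N$, then $\varphi([0,t],x)\subset L$; (3) if $x\in N$, $t_1>0$ and $\varphi(t_1,x)\notin N$, then there is $t_0\in[0,t_1]$ with $\varphi([0,t_0],x)\subset N$ and $\varphi(t_0,x)\in L$.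 It is a good index pair if moreover the projection $(N,L)\to(N/L,\mathrm{pt})$ induces isomorphisms $H_n(N,L)\cong H_n(N/L,\mathrm{pt})=\tilde H_n(N/L)$ for all $n$, where $H_\bullet$ is singular homology with integer coefficients, and $N/\emptyset$ is $N$ with a disjoint base point. The Conley index of $S$ is $CH_\bullet(S)=H_\bullet(N,L)$ for any good index pair $(N,L)$ for $S$. For a subset $Y\subset X$ that need not be invariant (such as $X$ or $R$ when $\varphi$ is only a semi-flow) put $CH_\bullet(Y)=CH_\bullet(\mathrm{Inv}(Y))$; for a flow, $\mathrm{Inv}(R)=R$ and $\mathrm{Inv}(X)=X$. \textbf{Theorem.} Let $(A,R)$ be an attractor-repeller pair. If $CH_n(R)=0$ for all $n$, then $CH_n(A)\cong CH_n(X)$ for all $n\ge 0$. The indices may be computed from arbitrary good index pairs: if $(N_A,L_A)$, $(N_R,L_R)$, $(N_X,L_X)$ are good index pairs for $A$, $\mathrm{Inv}(R)$, $\mathrm{Inv}(X)$ and $H_n(N_R,L_R)=0$ for all $n$, then $H_n(N_A,L_A)\cong H_n(N_X,L_X)$ for all $n\ge 0$. -/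

import Mathlib

open CategoryTheory CategoryTheory.Limits Set Filter Topology
open scoped NNReal

universe u

/-! ### Relative singular homology with integer coefficients -/

namespace SingularPair

/-- The singular chain complex functor with integer coefficients
(`ULift ℤ` is `ℤ`, moved to the universe of the spaces). -/
noncomputable def chainsFunctor : TopCat.{u} ⥤ ChainComplex (ModuleCat.{u} ℤ) ℕ :=
  (AlgebraicTopology.singularChainComplexFunctor (ModuleCat.{u} ℤ)).obj
    (ModuleCat.of ℤ (ULift.{u} ℤ))

/-- The singular chain complex of a topological space, with integer coefficients. -/
noncomputable abbrev chains (Y : Type u) [TopologicalSpace Y] :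
    ChainComplex (ModuleCat.{u} ℤ) ℕ :=
  chainsFunctor.obj (TopCat.of Y)

/-- The chain map induced by a continuous map. -/
noncomputable abbrev chainsMap {Y Z : Type u} [TopologicalSpace Y] [TopologicalSpace Z]
    (f : C(Y, Z)) : chains Y ⟶ chains Z :=
  chainsFunctor.map (TopCat.ofHom f)

/-- The inclusion of a subspace. -/
def incl {Y : Type u} [TopologicalSpace Y] (B : Set Y) : C(B, Y) :=
  ⟨Subtype.val, continuous_subtype_val⟩

/-- The restriction of a continuous map of pairs `(Y, B) ⟶ (Z, D)` to the subspaces. -/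
def restr {Y Z : Type u} [TopologicalSpace Y] [TopologicalSpace Z] {B : Set Y} {D : Set Z}
    (f : C(Y, Z)) (h : MapsTo f B D) : C(B, D) :=
  ⟨h.restrict f B D, f.continuous.restrict h⟩

/-- The relative singular chain complex `C(Y) / C(B)` of a pair `(Y, B)`. -/
noncomputable def relChains (Y : Type u) [TopologicalSpace Y] (B : Set Y) :
    ChainComplex (ModuleCat.{u} ℤ) ℕ :=
  cokernel (chainsMap (incl B))

/-- The map of relative singular chain complexes induced by a map of pairs. -/
noncomputable def relChainsMap {Y Z : Type u} [TopologicalSpace Y] [TopologicalSpace Z]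
    {B : Set Y} {D : Set Z} (f : C(Y, Z)) (h : MapsTo f B D) :
    relChains Y B ⟶ relChains Z D :=
  cokernel.map (chainsMap (incl B)) (chainsMap (incl D)) (chainsMap (restr f h)) (chainsMap f)
    (by rw [← Functor.map_comp, ← Functor.map_comp]; rfl)

/-- The relative singular homology group `H_n(Y, B; ℤ)`. -/
noncomputable def relHomology (Y : Type u) [TopologicalSpace Y] (B : Set Y) (n : ℕ) :
    ModuleCat.{u} ℤ :=
  (relChains Y B).homology n

/-- The quotient space `Y / B`, with its base point: a point is adjoined to `Y`, and `B` is
glued to it. For `B = ∅` this is `Y` with a disjoint base point. -/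
abbrev Collapse (Y : Type u) (B : Set Y) : Type u :=
  Quot fun a b : Y ⊕ PUnit.{u + 1} => ∃ y ∈ B, a = Sum.inl y ∧ b = Sum.inr PUnit.unit

/-- The base point of `Y / B`. -/
def Collapse.base {Y : Type u} (B : Set Y) : Collapse Y B := Quot.mk _ (Sum.inr PUnit.unit)

/-- The projection `Y ⟶ Y / B`. -/
def Collapse.proj {Y : Type u} [TopologicalSpace Y] (B : Set Y) : C(Y, Collapse Y B) :=
  ⟨fun y => Quot.mk _ (Sum.inl y), continuous_quot_mk.comp continuous_inl⟩

theorem Collapse.proj_mapsTo {Y : Type u} [TopologicalSpace Y] (B : Set Y) :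
    MapsTo (Collapse.proj B) B {Collapse.base B} :=
  fun y hy => Quot.sound ⟨y, hy, rfl, rfl⟩

/-- `(Y, B)` is a good pair if the projection `(Y, B) ⟶ (Y / B, pt)` induces isomorphisms
`H_n(Y, B) ≅ H_n(Y / B, pt)`, the reduced homology of `Y / B`, for all `n`. -/
def IsGood (Y : Type u) [TopologicalSpace Y] (B : Set Y) : Prop :=
  ∀ n : ℕ, IsIso (HomologicalComplex.homologyMap
    (relChainsMap (Collapse.proj B) (Collapse.proj_mapsTo B)) n)

end SingularPair

/-! ### Attractors, repellers and index pairs of a semi-flow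

A semi-flow on `X` is a `Flow ℝ≥0 X`. A flow is treated through the semi-flow of its
nonnegative times: none of the notions below involves negative times. -/

namespace ConleyTheory

variable {X : Type u} [TopologicalSpace X]

/-- `A` is an attractor: `ω(U) = A` for some neighborhood `U` of `A`. -/
def IsAttractor (φ : Flow ℝ≥0 X) (A : Set X) : Prop :=
  ∃ U ∈ 𝓝ˢ A, omegaLimit atTop φ U = A

/-- The dual repeller of `A`: the points whose `ω`-limit set does not meet `A`. -/
def dualRepeller (φ : Flow ℝ≥0 X) (A : Set X) : Set X :=
  {x | omegaLimit atTop φ {x} ∩ A = ∅}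

/-- `S` is an invariant set: `φ(t, S) = S` for all `t ≥ 0`. -/
def IsInvariantSet (φ : Flow ℝ≥0 X) (S : Set X) : Prop :=
  ∀ t : ℝ≥0, φ t '' S = S

/-- `Inv(N)`, the union of all invariant sets contained in `N`. -/
def maxInvariant (φ : Flow ℝ≥0 X) (N : Set X) : Set X :=
  ⋃₀ {S | S ⊆ N ∧ IsInvariantSet φ S}

/-- `Inv(S) = S` if `S` is invariant. -/
theorem maxInvariant_eq_self {φ : Flow ℝ≥0 X} {S : Set X} (h : IsInvariantSet φ S) :
    maxInvariant φ S = S :=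
  Subset.antisymm (sUnion_subset fun _ hT => hT.1) (subset_sUnion_of_mem ⟨Subset.rfl, h⟩)

/-- `(N, L)` is an index pair for `S`. -/
structure IsIndexPair (φ : Flow ℝ≥0 X) (S N L : Set X) : Prop where
  isCompact_left : IsCompact N
  isCompact_right : IsCompact L
  subset : L ⊆ N
  eq_maxInvariant : S = maxInvariant φ (closure (N \ L))
  mem_nhdsSet : N \ L ∈ 𝓝ˢ S
  positivelyInvariant : ∀ x ∈ L, ∀ t : ℝ≥0,
    (∀ s ∈ Icc 0 t, φ s x ∈ N) → ∀ s ∈ Icc 0 t, φ s x ∈ L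
  exitSet : ∀ x ∈ N, ∀ t₁ : ℝ≥0, 0 < t₁ → φ t₁ x ∉ N →
    ∃ t₀ ∈ Icc 0 t₁, (∀ s ∈ Icc 0 t₀, φ s x ∈ N) ∧ φ t₀ x ∈ L

/-- `(N, L)` is an index pair for `S` with `H_•(N, L) ≅ H̃_•(N / L)` through the projection
`N ⟶ N / L`. These are the index pairs whose relative homology is the Conley index of `S`. -/
structure IsGoodIndexPair (φ : Flow ℝ≥0 X) (S N L : Set X) : Prop
    extends IsIndexPair φ S N L where
  isGood : SingularPair.IsGood N (Subtype.val ⁻¹' L)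

/-- `H_n(N, L)`. For a good index pair `(N, L)` for `S` this is the Conley index `CH_n(S)`. -/
noncomputable def conleyHomology (N L : Set X) (n : ℕ) : ModuleCat.{u} ℤ :=
  SingularPair.relHomology N (Subtype.val ⁻¹' L) n

end ConleyTheory

/-!
# Attractor-repeller pairs with a repeller of trivial Conley index

An attractor `A` has an attractor block: a closed positively invariant neighborhood `N` inside a
neighborhood attracted by `A` (`IsAttractor.exists_block`). Then `(N, ∅)` is an index pair for `A`,
`(X, N)` is one for the invariant part of the dual repeller, and `(X, ∅)` is one for the invariant
part of `X`. If these pairs are good and the index does not depend on the good index pair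
(`IsGoodIndexPair.nonempty_iso`), the hypothesis says that `H_•(X, N) = 0`, and the exact sequence of
the pair `(X, N)` gives `H_n(N) ≅ H_n(X)`, which is the claim.

*Independence of the index pair.* For index pairs `(N, L)` and `(N', L')` of the same set, following
the flow for a long time `3T` defines a map `N / L → N' / L'`, in which an orbit is sent to the base
point unless it stays in `N \ L` during `[0, 2T]` and in `N' \ L'` during `[T, 3T]`. It is continuous
because orbits that stay in the closure of `N \ L` for a long time pass near the common invariant set
(`exists_forall_stays_mem`), hence through the interior of `N' \ L'`. The composite of the maps in both
directions is the time `6T` map of the flow on `N / L`, which is homotopic to the identity. So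
`N / L` and `N' / L'` are homotopy equivalent (`IsIndexPair.exists_quasiIso`), and for good pairs
their reduced homology is the index.

*Goodness.* The flow pushes a larger block `N'` into `N`. So passing from `N` to `N'`, and from the base
point of `X / N` to `N' / N`, changes no homology, and after excising `N` and the base point the two
pairs are homeomorphic (`isGood_of_deformation`). The excision theorem (`quasiIso_relChainsMap_incl`)
is proved by barycentric subdivision. The algebra of the subdivision is done for chains of tuples of
vertices in the standard simplex, transported to singular chains by naturality, and compared with the
singular chain complex, which is defined by coproducts, through `ofChain`.
-/

/-! ### Barycentric subdivision of chains of vertex tuples -/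

namespace VertexChains

/-- Formal integer combinations of `k`-tuples of points of `K`. The tuple `v` stands for the
`(k - 1)`-simplex with vertices `v 0, …, v (k - 1)`; the empty tuple is allowed, so that these groups
form the augmented complex. -/
abbrev Chain (K : Type*) (k : ℕ) := (Fin k → K) →₀ ℤ

variable {K K' : Type*}

/-- A linear map out of chains takes values in a submodule as soon as it does so on generators. -/
theorem map_mem_of_mem_supported {α M : Type*} [AddCommGroup M] (f : (α →₀ ℤ) →ₗ[ℤ] M)
    {s : Set α} {N : Submodule ℤ M} (h : ∀ a ∈ s, f (Finsupp.single a 1) ∈ N)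
    {c : α →₀ ℤ} (hc : c ∈ Finsupp.supported ℤ ℤ s) : f c ∈ N := by
  rw [Finsupp.supported_eq_span_single] at hc
  have : Submodule.span ℤ ((fun i => Finsupp.single i (1 : ℤ)) '' s) ≤ N.comap f := by
    rw [Submodule.span_le]
    rintro _ ⟨a, ha, rfl⟩
    exact h a ha
  exact this hc

/-- The boundary, which for `k = 0` is the augmentation. -/
noncomputable def bdry (k : ℕ) : Chain K (k + 1) →ₗ[ℤ] Chain K k :=
  Finsupp.linearCombination ℤ fun v =>
    ∑ i : Fin (k + 1), (-1 : ℤ) ^ (i : ℕ) • Finsupp.single (v ∘ i.succAbove) 1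

/-- The cone over a chain with apex `b`. -/
noncomputable def cone (b : K) (k : ℕ) : Chain K k →ₗ[ℤ] Chain K (k + 1) :=
  Finsupp.linearCombination ℤ fun v => Finsupp.single (Fin.cons b v : Fin (k + 1) → K) 1

/-- The map of chains induced by a map of vertices. -/
noncomputable def map (g : K → K') (k : ℕ) : Chain K k →ₗ[ℤ] Chain K' k :=
  Finsupp.linearCombination ℤ fun v => Finsupp.single (g ∘ v) 1

@[simp] theorem bdry_single {k : ℕ} (v : Fin (k + 1) → K) :
    bdry k (Finsupp.single v 1) =
      ∑ i : Fin (k + 1), (-1 : ℤ) ^ (i : ℕ) • Finsupp.single (v ∘ i.succAbove) 1 := by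
  simp [bdry]

@[simp] theorem cone_single (b : K) {k : ℕ} (v : Fin k → K) :
    cone b k (Finsupp.single v 1) = Finsupp.single (Fin.cons b v : Fin (k + 1) → K) 1 := by
  simp [cone]

@[simp] theorem map_single (g : K → K') {k : ℕ} (v : Fin k → K) :
    map g k (Finsupp.single v 1) = Finsupp.single (g ∘ v) 1 := by
  simp [map]

theorem bdry_cone_zero (b : K) (c : Chain K 0) : bdry 0 (cone b 0 c) = c := by
  refine LinearMap.congr_fun (f := bdry 0 ∘ₗ cone b 0) (g := LinearMap.id) ?_ c
  refine Finsupp.lhom_ext' fun v => LinearMap.ext_ring ?_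
  simp only [LinearMap.comp_apply, Finsupp.lsingle_apply, cone_single, bdry_single,
    LinearMap.id_apply]
  simp [Subsingleton.elim _ v]

theorem cons_comp_succ_succAbove (b : K) {k : ℕ} (v : Fin (k + 1) → K) (i : Fin (k + 1)) :
    (Fin.cons b v : Fin (k + 2) → K) ∘ i.succ.succAbove =
      (Fin.cons b (v ∘ i.succAbove) : Fin (k + 1) → K) := by
  funext j
  refine Fin.cases ?_ (fun j => ?_) j
  · simp
  · simp [Fin.succ_succAbove_succ]

theorem bdry_cone (b : K) {k : ℕ} (c : Chain K (k + 1)) :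
    bdry (k + 1) (cone b (k + 1) c) = c - cone b k (bdry k c) := by
  refine LinearMap.congr_fun (f := bdry (k + 1) ∘ₗ cone b (k + 1))
    (g := LinearMap.id - cone b k ∘ₗ bdry k) ?_ c
  refine Finsupp.lhom_ext' fun v => LinearMap.ext_ring ?_
  simp only [LinearMap.comp_apply, Finsupp.lsingle_apply, cone_single, bdry_single,
    LinearMap.sub_apply, LinearMap.id_apply, map_sum, map_zsmul]
  rw [Fin.sum_univ_succ]
  simp only [cons_comp_succ_succAbove, Fin.val_succ, pow_succ, mul_neg, mul_one, neg_smul,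
    Finset.sum_neg_distrib, sub_eq_add_neg]
  congr 1
  simp only [Fin.val_zero, pow_zero, one_smul]
  congr 1

theorem bdry_bdry {k : ℕ} (c : Chain K (k + 2)) : bdry k (bdry (k + 1) c) = 0 := by
  refine LinearMap.congr_fun (f := bdry k ∘ₗ bdry (k + 1)) (g := 0) ?_ c
  refine Finsupp.lhom_ext' fun v => LinearMap.ext_ring ?_
  -- Every generator is the cone from its first vertex over its opposite face.
  have hv : Finsupp.single v (1 : ℤ) = cone (v 0) (k + 1) (Finsupp.single (Fin.tail v) 1) := by
    rw [cone_single, Fin.cons_self_tail]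
  simp only [LinearMap.comp_apply, Finsupp.lsingle_apply, LinearMap.zero_apply]
  rw [hv, bdry_cone, map_sub]
  induction k with
  | zero => rw [bdry_cone_zero, sub_self]
  | succ k ih =>
    rw [bdry_cone, sub_sub_cancel]
    have h0 : bdry k (bdry (k + 1) (Finsupp.single (Fin.tail v) (1 : ℤ))) = 0 := by
      have hv' : Finsupp.single (Fin.tail v) (1 : ℤ) =
          cone (Fin.tail v 0) (k + 1) (Finsupp.single (Fin.tail (Fin.tail v)) 1) := by
        rw [cone_single, Fin.cons_self_tail]
      rw [hv', bdry_cone, map_sub]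
      exact ih (Finsupp.single (Fin.tail v) 1) (Fin.tail v) hv'
    rw [h0, map_zero]

/-- Subdivision. The function `b` chooses the new vertex in each simplex; for the barycentric
subdivision it is the barycenter, but none of the identities below depends on this. -/
noncomputable def sd (b : ∀ k, (Fin (k + 1) → K) → K) : ∀ k, Chain K k →ₗ[ℤ] Chain K k
  | 0 => LinearMap.id
  | k + 1 => Finsupp.linearCombination ℤ fun v =>
      cone (b k v) k (sd b k (bdry k (Finsupp.single v 1)))

/-- The chain homotopy from the identity to the subdivision. -/
noncomputable def sdHomotopy (b : ∀ k, (Fin (k + 1) → K) → K) :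
    ∀ k, Chain K k →ₗ[ℤ] Chain K (k + 1)
  | 0 => 0
  | k + 1 => Finsupp.linearCombination ℤ fun v =>
      cone (b k v) (k + 1) (Finsupp.single v 1 - sdHomotopy b k (bdry k (Finsupp.single v 1)))

section

variable (b : ∀ k, (Fin (k + 1) → K) → K)

theorem sd_single {k : ℕ} (v : Fin (k + 1) → K) :
    sd b (k + 1) (Finsupp.single v 1) =
      cone (b k v) k (sd b k (bdry k (Finsupp.single v 1))) := by
  simp [sd]

theorem sdHomotopy_single {k : ℕ} (v : Fin (k + 1) → K) :
    sdHomotopy b (k + 1) (Finsupp.single v 1) =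
      cone (b k v) (k + 1)
        (Finsupp.single v 1 - sdHomotopy b k (bdry k (Finsupp.single v 1))) := by
  simp [sdHomotopy]

theorem bdry_sd {k : ℕ} (c : Chain K (k + 1)) :
    bdry k (sd b (k + 1) c) = sd b k (bdry k c) := by
  induction k with
  | zero =>
    refine LinearMap.congr_fun (f := bdry 0 ∘ₗ sd b 1) (g := sd b 0 ∘ₗ bdry 0) ?_ c
    refine Finsupp.lhom_ext' fun v => LinearMap.ext_ring ?_
    simp only [LinearMap.comp_apply, Finsupp.lsingle_apply]
    rw [sd_single, bdry_cone_zero]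
  | succ k ih =>
    refine LinearMap.congr_fun (f := bdry (k + 1) ∘ₗ sd b (k + 2))
      (g := sd b (k + 1) ∘ₗ bdry (k + 1)) ?_ c
    refine Finsupp.lhom_ext' fun v => LinearMap.ext_ring ?_
    simp only [LinearMap.comp_apply, Finsupp.lsingle_apply]
    rw [sd_single, bdry_cone, ih, bdry_bdry, map_zero, map_zero, sub_zero]

theorem bdry_sdHomotopy_add {k : ℕ} (c : Chain K (k + 1)) :
    bdry (k + 1) (sdHomotopy b (k + 1) c) + sdHomotopy b k (bdry k c) = c - sd b (k + 1) c := by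
  induction k with
  | zero =>
    refine LinearMap.congr_fun (f := bdry 1 ∘ₗ sdHomotopy b 1 + sdHomotopy b 0 ∘ₗ bdry 0)
      (g := LinearMap.id - sd b 1) ?_ c
    refine Finsupp.lhom_ext' fun v => LinearMap.ext_ring ?_
    simp only [LinearMap.comp_apply, Finsupp.lsingle_apply, LinearMap.add_apply,
      LinearMap.sub_apply, LinearMap.id_apply]
    rw [sdHomotopy_single, bdry_cone, sd_single]
    simp only [sdHomotopy, sd, LinearMap.zero_apply, sub_zero, add_zero, LinearMap.id_apply]
  | succ k ih =>
    refine LinearMap.congr_fun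
      (f := bdry (k + 2) ∘ₗ sdHomotopy b (k + 2) + sdHomotopy b (k + 1) ∘ₗ bdry (k + 1))
      (g := LinearMap.id - sd b (k + 2)) ?_ c
    refine Finsupp.lhom_ext' fun v => LinearMap.ext_ring ?_
    simp only [LinearMap.comp_apply, Finsupp.lsingle_apply, LinearMap.add_apply,
      LinearMap.sub_apply, LinearMap.id_apply]
    have h := ih (bdry (k + 1) (Finsupp.single v 1))
    rw [bdry_bdry, map_zero, add_zero] at h
    rw [sdHomotopy_single, bdry_cone, map_sub, h, sd_single, sub_sub_cancel]
    abel

/-- The chain homotopy from the identity to the `r`-fold subdivision. -/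
noncomputable def sdIterHomotopy (r k : ℕ) : Chain K k →ₗ[ℤ] Chain K (k + 1) :=
  ∑ i ∈ Finset.range r, sdHomotopy b k ∘ₗ (sd b k) ^ i

theorem bdry_sd_pow (r : ℕ) {k : ℕ} (c : Chain K (k + 1)) :
    bdry k ((sd b (k + 1) ^ r) c) = (sd b k ^ r) (bdry k c) := by
  induction r with
  | zero => simp
  | succ r ih => rw [pow_succ', pow_succ', Module.End.mul_apply, Module.End.mul_apply, bdry_sd, ih]

theorem bdry_sdIterHomotopy_add (r : ℕ) {k : ℕ} (c : Chain K (k + 1)) :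
    bdry (k + 1) (sdIterHomotopy b r (k + 1) c) + sdIterHomotopy b r k (bdry k c) =
      c - (sd b (k + 1) ^ r) c := by
  induction r with
  | zero => simp [sdIterHomotopy]
  | succ r ih =>
    have h := bdry_sdHomotopy_add b ((sd b (k + 1) ^ r) c)
    rw [bdry_sd_pow] at h
    have e : ∀ j (x : Chain K j), sdIterHomotopy b (r + 1) j x =
        sdIterHomotopy b r j x + sdHomotopy b j ((sd b j ^ r) x) := by
      intro j x
      simp [sdIterHomotopy, Finset.sum_range_succ]
    rw [e, e, map_add, pow_succ', Module.End.mul_apply]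
    calc _ = (bdry (k + 1) (sdIterHomotopy b r (k + 1) c) + sdIterHomotopy b r k (bdry k c)) +
          (bdry (k + 1) (sdHomotopy b (k + 1) ((sd b (k + 1) ^ r) c)) +
            sdHomotopy b k ((sd b k ^ r) (bdry k c))) := by abel
      _ = _ := by rw [ih, h]; abel

end

/-! ### Naturality of the subdivision -/

section

variable (g : K → K')

theorem map_bdry {k : ℕ} (c : Chain K (k + 1)) : map g k (bdry k c) = bdry k (map g (k + 1) c) := by
  refine LinearMap.congr_fun (f := map g k ∘ₗ bdry k) (g := bdry k ∘ₗ map g (k + 1)) ?_ c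
  refine Finsupp.lhom_ext' fun v => LinearMap.ext_ring ?_
  simp only [LinearMap.comp_apply, Finsupp.lsingle_apply, bdry_single, map_single, map_sum,
    map_zsmul, Function.comp_assoc]

theorem map_cone (b : K) {k : ℕ} (c : Chain K k) :
    map g (k + 1) (cone b k c) = cone (g b) k (map g k c) := by
  refine LinearMap.congr_fun (f := map g (k + 1) ∘ₗ cone b k) (g := cone (g b) k ∘ₗ map g k) ?_ c
  refine Finsupp.lhom_ext' fun v => LinearMap.ext_ring ?_
  simp [Fin.comp_cons]

variable {g} {b : ∀ k, (Fin (k + 1) → K) → K} {b' : ∀ k, (Fin (k + 1) → K') → K'}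

theorem map_sd (h : ∀ k v, g (b k v) = b' k (g ∘ v)) {k : ℕ} (c : Chain K k) :
    map g k (sd b k c) = sd b' k (map g k c) := by
  induction k with
  | zero => rfl
  | succ k ih =>
    refine LinearMap.congr_fun (f := map g (k + 1) ∘ₗ sd b (k + 1))
      (g := sd b' (k + 1) ∘ₗ map g (k + 1)) ?_ c
    refine Finsupp.lhom_ext' fun v => LinearMap.ext_ring ?_
    simp only [LinearMap.comp_apply, Finsupp.lsingle_apply]
    rw [sd_single, map_cone, ih, map_bdry, h, map_single, sd_single]

theorem map_sdHomotopy (h : ∀ k v, g (b k v) = b' k (g ∘ v)) {k : ℕ} (c : Chain K k) :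
    map g (k + 1) (sdHomotopy b k c) = sdHomotopy b' k (map g k c) := by
  induction k with
  | zero => simp [sdHomotopy]
  | succ k ih =>
    refine LinearMap.congr_fun (f := map g (k + 2) ∘ₗ sdHomotopy b (k + 1))
      (g := sdHomotopy b' (k + 1) ∘ₗ map g (k + 1)) ?_ c
    refine Finsupp.lhom_ext' fun v => LinearMap.ext_ring ?_
    simp only [LinearMap.comp_apply, Finsupp.lsingle_apply]
    rw [sdHomotopy_single, map_cone, map_sub, ih, map_bdry, h, map_single, sdHomotopy_single]

theorem map_sdIterHomotopy (h : ∀ k v, g (b k v) = b' k (g ∘ v)) (r : ℕ) {k : ℕ}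
    (c : Chain K k) :
    map g (k + 1) (sdIterHomotopy b r k c) = sdIterHomotopy b' r k (map g k c) := by
  have hp : ∀ i, map g k ((sd b k ^ i) c) = (sd b' k ^ i) (map g k c) := by
    intro i
    induction i with
    | zero => rfl
    | succ i ih =>
      rw [pow_succ', pow_succ', Module.End.mul_apply, Module.End.mul_apply, map_sd h, ih]
  simp [sdIterHomotopy, map_sdHomotopy h, hp]

end

end VertexChains

/-! ### Affine singular simplices of the standard simplex -/

namespace AffineSimplex

variable {ι κ μ : Type*} [Fintype ι] [Fintype κ] [Fintype μ]

/-- The affine map of standard simplices with prescribed values on the vertices. -/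
noncomputable def aff (v : ι → stdSimplex ℝ κ) : C(stdSimplex ℝ ι, stdSimplex ℝ κ) where
  toFun t := ⟨∑ i, t i • (v i : κ → ℝ),
    (convex_stdSimplex ℝ κ).sum_mem (fun i _ => t.2.1 i) t.2.2 (fun i _ => (v i).2)⟩
  continuous_toFun := by
    have h : Continuous fun t : stdSimplex ℝ ι => ∑ i, t i • (v i : κ → ℝ) := by
      refine continuous_finsetSum _ fun i _ => ?_
      have hi : Continuous fun t : stdSimplex ℝ ι => (t : ι → ℝ) i :=
        (continuous_apply i).comp continuous_subtype_val
      exact hi.smul continuous_const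
    exact h.subtype_mk _

theorem coe_aff (v : ι → stdSimplex ℝ κ) (t : stdSimplex ℝ ι) :
    (aff v t : κ → ℝ) = ∑ i, t i • (v i : κ → ℝ) := rfl

theorem aff_apply (v : ι → stdSimplex ℝ κ) (t : stdSimplex ℝ ι) (j : κ) :
    (aff v t) j = ∑ i, t i * v i j := by
  have := congrFun (coe_aff v t) j
  simpa [Finset.sum_apply] using! this

theorem aff_aff (u : κ → stdSimplex ℝ μ) (v : ι → stdSimplex ℝ κ) (t : stdSimplex ℝ ι) :
    aff u (aff v t) = aff (aff u ∘ v) t := by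
  ext j
  simp only [aff_apply, Function.comp_apply, Finset.sum_mul, Finset.mul_sum, mul_assoc]
  exact Finset.sum_comm

theorem aff_comp_aff (u : κ → stdSimplex ℝ μ) (v : ι → stdSimplex ℝ κ) :
    (aff u).comp (aff v) = aff (aff u ∘ v) :=
  ContinuousMap.ext fun t => aff_aff u v t

theorem aff_vertex [DecidableEq ι] : aff (stdSimplex.vertex : ι → stdSimplex ℝ ι) = .id _ := by
  refine ContinuousMap.ext fun t => ?_
  ext j
  simp [aff_apply, Pi.single_apply]

theorem aff_apply_vertex [DecidableEq ι] (v : ι → stdSimplex ℝ κ) (i : ι) :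
    aff v (stdSimplex.vertex i) = v i := by
  ext j
  simp [aff_apply, Pi.single_apply]

theorem map_eq_aff [DecidableEq κ] (f : ι → κ) (t : stdSimplex ℝ ι) :
    stdSimplex.map f t = aff (fun i => stdSimplex.vertex (f i)) t := by
  classical
  ext j
  simp [aff_apply, FunOnFinite.linearMap_apply_apply, Pi.single_apply, Finset.sum_filter, eq_comm]

theorem aff_mem_convexHull (v : ι → stdSimplex ℝ κ) (t : stdSimplex ℝ ι) :
    (aff v t : κ → ℝ) ∈ convexHull ℝ (range fun i => (v i : κ → ℝ)) := by
  rw [coe_aff]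
  exact (convex_convexHull ℝ _).sum_mem (fun i _ => t.2.1 i) t.2.2
    (fun i _ => subset_convexHull ℝ _ (mem_range_self i))

/-- The barycenter of the affine simplex with vertices `v`. -/
noncomputable def bary (k : ℕ) (v : Fin (k + 1) → stdSimplex ℝ κ) : stdSimplex ℝ κ :=
  aff v stdSimplex.barycenter

theorem aff_bary (u : κ → stdSimplex ℝ μ) (k : ℕ) (v : Fin (k + 1) → stdSimplex ℝ κ) :
    aff u (bary k v) = bary k (aff u ∘ v) :=
  aff_aff u v _

/-- The barycenter divides each median of a `k`-simplex of diameter at most `d` in such a way that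
it is at distance at most `k / (k + 1) * d` from every vertex. -/
theorem dist_bary_le {k : ℕ} (v : Fin (k + 1) → stdSimplex ℝ κ) {d : ℝ}
    (h : ∀ i j, dist (v i) (v j) ≤ d) (i : Fin (k + 1)) :
    dist (v i) (bary k v) ≤ (k / (k + 1) : ℝ) * d := by
  have hk : (0 : ℝ) < k + 1 := by positivity
  have e : (v i : κ → ℝ) - (bary k v : κ → ℝ) =
      ((k : ℝ) + 1)⁻¹ • ∑ j, ((v i : κ → ℝ) - (v j : κ → ℝ)) := by
    have hb : (bary k v : κ → ℝ) = ((k : ℝ) + 1)⁻¹ • ∑ j, (v j : κ → ℝ) := by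
      rw [bary, coe_aff, Finset.smul_sum]
      refine Finset.sum_congr rfl fun j _ => ?_
      congr 1
      change ((Fintype.card (Fin (k + 1)) : ℝ))⁻¹ = _
      simp
    rw [hb, Finset.sum_sub_distrib, smul_sub, Finset.sum_const, Finset.card_univ,
      Fintype.card_fin, ← Nat.cast_smul_eq_nsmul ℝ, smul_smul]
    congr 1
    push_cast
    rw [inv_mul_cancel₀ hk.ne', one_smul]
  rw [Subtype.dist_eq, dist_eq_norm]
  change ‖(v i : κ → ℝ) - (bary k v : κ → ℝ)‖ ≤ _
  rw [e, norm_smul, norm_inv, Real.norm_of_nonneg hk.le]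
  have hs : ‖∑ j, ((v i : κ → ℝ) - (v j : κ → ℝ))‖ ≤ k * d := by
    rw [Fin.sum_univ_succAbove _ i, sub_self, zero_add]
    refine (norm_sum_le _ _).trans ?_
    refine (Finset.sum_le_card_nsmul _ _ d fun j _ => ?_).trans ?_
    · rw [← dist_eq_norm]; exact h i _
    · simp
  calc ((k : ℝ) + 1)⁻¹ * _ ≤ ((k : ℝ) + 1)⁻¹ * (k * d) := by gcongr
    _ = _ := by ring

open VertexChains

/-- The simplices of the subdivision of a simplex with at most `N + 1` vertices are smaller by the
factor `N / (N + 1)`, and their vertices lie in the original simplex. -/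
theorem sd_single_mem (N : ℕ) {k : ℕ} (hk : k ≤ N + 1) (v : Fin k → stdSimplex ℝ κ) {d : ℝ}
    (hd : 0 ≤ d) (h : ∀ i j, dist (v i) (v j) ≤ d) :
    sd bary k (Finsupp.single v 1) ∈ Finsupp.supported ℤ ℤ
      {w : Fin k → stdSimplex ℝ κ | (∀ i j, dist (w i) (w j) ≤ (N / (N + 1) : ℝ) * d) ∧
        ∀ i, (w i : κ → ℝ) ∈ convexHull ℝ (range fun i => (v i : κ → ℝ))} := by
  induction k with
  | zero =>
    refine Finsupp.single_mem_supported ℤ 1 ⟨fun i => i.elim0, fun i => i.elim0⟩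
  | succ k ih =>
    rw [sd_single, bdry_single, map_sum, map_sum]
    refine Submodule.sum_mem _ fun i _ => ?_
    rw [map_zsmul, map_zsmul]
    refine Submodule.smul_mem _ _ ?_
    refine map_mem_of_mem_supported _ ?_ (ih (by omega) (v ∘ i.succAbove) fun _ _ => h _ _)
    rintro w ⟨hw, hwv⟩
    rw [cone_single]
    refine Finsupp.single_mem_supported ℤ 1 ?_
    have hwv' : ∀ j, (w j : κ → ℝ) ∈ convexHull ℝ (range fun i => (v i : κ → ℝ)) := fun j =>
      convexHull_mono (range_comp_subset_range i.succAbove fun i => (v i : κ → ℝ)) (hwv j)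
    have hb : ∀ j, dist (w j) (bary k v) ≤ (N / (N + 1) : ℝ) * d := by
      intro j
      have hsub : convexHull ℝ (range fun i => (v i : κ → ℝ)) ⊆
          Metric.closedBall (bary k v : κ → ℝ) ((N / (N + 1) : ℝ) * d) := by
        refine convexHull_min (range_subset_iff.2 fun i => ?_) (convex_closedBall _ _)
        refine (dist_bary_le v h i).trans (mul_le_mul_of_nonneg_right ?_ hd)
        rw [div_le_div_iff₀ (by positivity) (by positivity)]
        have : (k : ℝ) ≤ N := by exact_mod_cast (by omega : k ≤ N)
        nlinarith
      exact hsub (hwv' j)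
    refine ⟨fun a => ?_, fun a => ?_⟩
    · refine Fin.cases (fun c => ?_) (fun a c => ?_) a
      · refine Fin.cases ?_ (fun c => ?_) c
        · simp only [dist_self]; positivity
        · rw [Fin.cons_zero, Fin.cons_succ, dist_comm]; exact hb c
      · refine Fin.cases ?_ (fun c => ?_) c
        · rw [Fin.cons_zero, Fin.cons_succ]; exact hb a
        · rw [Fin.cons_succ, Fin.cons_succ]; exact hw a c
    · refine Fin.cases ?_ (fun a => ?_) a
      · rw [Fin.cons_zero]; exact aff_mem_convexHull v _
      · rw [Fin.cons_succ]; exact hwv' a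

theorem sd_pow_single_mem (N : ℕ) (v : Fin (N + 1) → stdSimplex ℝ κ) {d : ℝ}
    (hd : 0 ≤ d) (h : ∀ i j, dist (v i) (v j) ≤ d) (r : ℕ) :
    (sd bary (N + 1) ^ r) (Finsupp.single v 1) ∈ Finsupp.supported ℤ ℤ
      {w : Fin (N + 1) → stdSimplex ℝ κ |
        ∀ i j, dist (w i) (w j) ≤ (N / (N + 1) : ℝ) ^ r * d} := by
  induction r with
  | zero => exact Finsupp.single_mem_supported ℤ 1 (by simpa using h)
  | succ r ih =>
    rw [pow_succ' (sd bary (N + 1)), Module.End.mul_apply]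
    refine map_mem_of_mem_supported _ (fun w hw => ?_) ih
    have := sd_single_mem N le_rfl w (by positivity) hw
    refine Finsupp.supported_mono (fun u hu => ?_) this
    intro i j
    rw [pow_succ', mul_assoc]
    exact hu.1 i j

/-- The affine simplex spanned by points at mutual distance at most `d` lies in the closed ball of
radius `d` around any of them. -/
theorem dist_aff_le {k : ℕ} (w : Fin (k + 1) → stdSimplex ℝ κ) {d : ℝ}
    (h : ∀ i j, dist (w i) (w j) ≤ d) (t : stdSimplex ℝ (Fin (k + 1))) :
    dist (aff w t) (w 0) ≤ d := by
  have hsub : convexHull ℝ (range fun i => (w i : κ → ℝ)) ⊆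
      Metric.closedBall (w 0 : κ → ℝ) d :=
    convexHull_min (range_subset_iff.2 fun i => h i 0) (convex_closedBall _ _)
  exact hsub (aff_mem_convexHull w t)

end AffineSimplex

/-! ### Singular chains as formal sums, and the small simplices theorem -/

namespace SingularSimplex

open VertexChains AffineSimplex

variable {Y Z : Type*} [TopologicalSpace Y] [TopologicalSpace Z]

/-- Formal integer combinations of singular `n`-simplices of `Y`. -/
abbrev Chain (n : ℕ) (Y : Type*) [TopologicalSpace Y] := C(stdSimplex ℝ (Fin (n + 1)), Y) →₀ ℤ

/-- The inclusion of the `i`-th face of the standard simplex. -/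
noncomputable def faceMap (n : ℕ) (i : Fin (n + 2)) :
    C(stdSimplex ℝ (Fin (n + 1)), stdSimplex ℝ (Fin (n + 2))) :=
  ⟨stdSimplex.map i.succAbove, stdSimplex.continuous_map _⟩

/-- The singular boundary. -/
noncomputable def bdry (n : ℕ) : Chain (n + 1) Y →ₗ[ℤ] Chain n Y :=
  Finsupp.linearCombination ℤ fun σ =>
    ∑ i : Fin (n + 2), (-1 : ℤ) ^ (i : ℕ) • Finsupp.single (σ.comp (faceMap n i)) 1

theorem bdry_single {n : ℕ} (σ : C(stdSimplex ℝ (Fin (n + 2)), Y)) :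
    bdry n (Finsupp.single σ 1) =
      ∑ i : Fin (n + 2), (-1 : ℤ) ^ (i : ℕ) • Finsupp.single (σ.comp (faceMap n i)) 1 := by
  simp [bdry]

/-- A singular simplex `σ` turns affine chains of the standard simplex into singular chains. -/
noncomputable def push {n : ℕ} (σ : C(stdSimplex ℝ (Fin (n + 1)), Y)) (m : ℕ) :
    VertexChains.Chain (stdSimplex ℝ (Fin (n + 1))) (m + 1) →ₗ[ℤ] Chain m Y :=
  Finsupp.linearCombination ℤ fun v => Finsupp.single (σ.comp (aff v)) 1

theorem push_single {n : ℕ} (σ : C(stdSimplex ℝ (Fin (n + 1)), Y)) {m : ℕ}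
    (v : Fin (m + 1) → stdSimplex ℝ (Fin (n + 1))) :
    push σ m (Finsupp.single v 1) = Finsupp.single (σ.comp (aff v)) 1 := by
  simp [push]

theorem aff_comp_faceMap {ι : Type*} [Fintype ι] {m : ℕ} (v : Fin (m + 2) → stdSimplex ℝ ι)
    (i : Fin (m + 2)) : (aff v).comp (faceMap m i) = aff (v ∘ i.succAbove) := by
  refine ContinuousMap.ext fun t => ?_
  change aff v (stdSimplex.map i.succAbove t) = _
  rw [map_eq_aff, aff_aff]
  congr 2
  funext j
  exact aff_apply_vertex _ _

theorem bdry_push {n : ℕ} (σ : C(stdSimplex ℝ (Fin (n + 1)), Y)) {m : ℕ}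
    (c : VertexChains.Chain (stdSimplex ℝ (Fin (n + 1))) (m + 2)) :
    bdry m (push σ (m + 1) c) = push σ m (VertexChains.bdry (m + 1) c) := by
  refine LinearMap.congr_fun (f := bdry m ∘ₗ push σ (m + 1))
    (g := push σ m ∘ₗ VertexChains.bdry (m + 1)) ?_ c
  refine Finsupp.lhom_ext' fun v => LinearMap.ext_ring ?_
  simp only [LinearMap.comp_apply, Finsupp.lsingle_apply, push_single, bdry_single,
    VertexChains.bdry_single, map_sum, map_zsmul, ContinuousMap.comp_assoc, aff_comp_faceMap]

theorem push_comp_aff {n p : ℕ} (σ : C(stdSimplex ℝ (Fin (n + 1)), Y))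
    (u : Fin (p + 1) → stdSimplex ℝ (Fin (n + 1))) {m : ℕ}
    (c : VertexChains.Chain (stdSimplex ℝ (Fin (p + 1))) (m + 1)) :
    push (σ.comp (aff u)) m c = push σ m (VertexChains.map (aff u) (m + 1) c) := by
  refine LinearMap.congr_fun (f := push (σ.comp (aff u)) m)
    (g := push σ m ∘ₗ VertexChains.map (aff u) (m + 1)) ?_ c
  refine Finsupp.lhom_ext' fun v => LinearMap.ext_ring ?_
  simp only [LinearMap.comp_apply, Finsupp.lsingle_apply, push_single, VertexChains.map_single,
    ContinuousMap.comp_assoc, aff_comp_aff]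

/-- The tautological generator, the standard simplex as an affine simplex of itself. -/
noncomputable def idChain (n : ℕ) : VertexChains.Chain (stdSimplex ℝ (Fin (n + 1))) (n + 1) :=
  Finsupp.single (fun i => stdSimplex.vertex i) 1

theorem push_idChain {n : ℕ} (σ : C(stdSimplex ℝ (Fin (n + 1)), Y)) :
    push σ n (idChain n) = Finsupp.single σ 1 := by
  rw [idChain, push_single]
  congr 1
  exact (congrArg σ.comp aff_vertex).trans σ.comp_id

theorem faceMap_eq_aff (n : ℕ) (i : Fin (n + 2)) :
    faceMap n i = aff fun j => stdSimplex.vertex (i.succAbove j) :=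
  ContinuousMap.ext fun t => map_eq_aff _ t

theorem map_faceMap_idChain (n : ℕ) (i : Fin (n + 2)) :
    VertexChains.map (faceMap n i) (n + 1) (idChain n) =
      Finsupp.single (fun j => stdSimplex.vertex (i.succAbove j)) 1 := by
  rw [idChain, VertexChains.map_single]
  congr 1
  funext j
  rw [faceMap_eq_aff]
  exact aff_apply_vertex _ _

/-- The `r`-fold barycentric subdivision of singular chains. -/
noncomputable def subdiv (r n : ℕ) : Chain n Y →ₗ[ℤ] Chain n Y :=
  Finsupp.linearCombination ℤ fun σ => push σ n ((sd bary (n + 1) ^ r) (idChain n))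

/-- The chain homotopy from the identity to the `r`-fold barycentric subdivision. -/
noncomputable def subdivHomotopy (r n : ℕ) : Chain n Y →ₗ[ℤ] Chain (n + 1) Y :=
  Finsupp.linearCombination ℤ fun σ => push σ (n + 1) (sdIterHomotopy bary r (n + 1) (idChain n))

theorem subdiv_single {r n : ℕ} (σ : C(stdSimplex ℝ (Fin (n + 1)), Y)) :
    subdiv r n (Finsupp.single σ 1) = push σ n ((sd bary (n + 1) ^ r) (idChain n)) := by
  simp [subdiv]

theorem subdivHomotopy_single {r n : ℕ} (σ : C(stdSimplex ℝ (Fin (n + 1)), Y)) :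
    subdivHomotopy r n (Finsupp.single σ 1) =
      push σ (n + 1) (sdIterHomotopy bary r (n + 1) (idChain n)) := by
  simp [subdivHomotopy]

theorem bdry_subdivHomotopy_add (r : ℕ) {n : ℕ} (c : Chain (n + 1) Y) :
    bdry (n + 1) (subdivHomotopy r (n + 1) c) + subdivHomotopy r n (bdry n c) =
      c - subdiv r (n + 1) c := by
  refine LinearMap.congr_fun
    (f := bdry (n + 1) ∘ₗ subdivHomotopy r (n + 1) + subdivHomotopy r n ∘ₗ bdry n)
    (g := LinearMap.id - subdiv r (n + 1)) ?_ c
  refine Finsupp.lhom_ext' fun σ => LinearMap.ext_ring ?_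
  simp only [LinearMap.comp_apply, Finsupp.lsingle_apply, LinearMap.add_apply,
    LinearMap.sub_apply, LinearMap.id_apply, subdivHomotopy_single, subdiv_single, bdry_push]
  -- By naturality of the affine homotopy, the homotopy of a face is computed inside the simplex.
  have hface : ∀ i : Fin (n + 2),
      push (σ.comp (faceMap n i)) (n + 1) (sdIterHomotopy bary r (n + 1) (idChain n)) =
        push σ (n + 1) (sdIterHomotopy bary r (n + 1)
          (Finsupp.single (fun j => stdSimplex.vertex (i.succAbove j)) 1)) := by
    intro i
    rw [← map_faceMap_idChain, faceMap_eq_aff, push_comp_aff,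
      map_sdIterHomotopy (fun k v => aff_bary _ k v)]
  have hb : subdivHomotopy r n (bdry n (Finsupp.single σ 1)) =
      push σ (n + 1) (sdIterHomotopy bary r (n + 1)
        (VertexChains.bdry (n + 1) (idChain (n + 1)))) := by
    rw [bdry_single, idChain, VertexChains.bdry_single]
    simp only [map_sum, map_zsmul, subdivHomotopy_single, hface]
    rfl
  rw [hb, ← map_add, bdry_sdIterHomotopy_add, map_sub, push_idChain]

/-- Chains that are sums of simplices contained in `V` or in `W`. -/
noncomputable def small (n : ℕ) (V W : Set Y) : Submodule ℤ (Chain n Y) :=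
  Finsupp.supported ℤ ℤ {σ | range σ ⊆ V ∨ range σ ⊆ W}

theorem push_mem_small {n : ℕ} {V W : Set Y} {σ : C(stdSimplex ℝ (Fin (n + 1)), Y)}
    (hσ : range σ ⊆ V ∨ range σ ⊆ W) {m : ℕ}
    (c : VertexChains.Chain (stdSimplex ℝ (Fin (n + 1))) (m + 1)) :
    push σ m c ∈ small m V W := by
  refine map_mem_of_mem_supported _ (s := univ) (fun v _ => ?_) (by simp)
  rw [push_single]
  refine Finsupp.single_mem_supported ℤ 1 ?_
  have h : range (σ.comp (aff v)) ⊆ range σ := range_subset_iff.2 fun t => ⟨_, rfl⟩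
  exact hσ.imp h.trans h.trans

theorem subdivHomotopy_mem_small {n : ℕ} {V W : Set Y} (r : ℕ) {c : Chain n Y}
    (hc : c ∈ small n V W) : subdivHomotopy r n c ∈ small (n + 1) V W := by
  refine map_mem_of_mem_supported _ (fun σ hσ => ?_) hc
  rw [subdivHomotopy_single]
  exact push_mem_small hσ _

/-- Sufficiently fine subdivisions of a single simplex are small, by Lebesgue's number lemma. -/
theorem eventually_subdiv_single_mem_small {V W : Set Y} (h : interior V ∪ interior W = univ)
    {n : ℕ} (σ : C(stdSimplex ℝ (Fin (n + 1)), Y)) :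
    ∀ᶠ r in atTop, subdiv r n (Finsupp.single σ 1) ∈ small n V W := by
  obtain ⟨δ, hδ, hball⟩ := lebesgue_number_lemma_of_metric (s := (univ : Set (stdSimplex ℝ _)))
    (c := fun b : Bool => bif b then σ ⁻¹' interior V else σ ⁻¹' interior W) isCompact_univ
    (by rintro (_ | _) <;> exact isOpen_interior.preimage σ.continuous)
    (by
      intro t _
      have : σ t ∈ interior V ∪ interior W := h ▸ mem_univ _
      rcases this with h | h
      · exact mem_iUnion.2 ⟨true, h⟩
      · exact mem_iUnion.2 ⟨false, h⟩)
  have hlim : Tendsto (fun r : ℕ => (n / (n + 1) : ℝ) ^ r * 1) atTop (𝓝 (0 * 1)) := by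
    refine (tendsto_pow_atTop_nhds_zero_of_lt_one (by positivity) ?_).mul_const 1
    rw [div_lt_one (by positivity)]
    linarith
  rw [zero_mul] at hlim
  filter_upwards [hlim.eventually (gt_mem_nhds hδ)] with r hr
  rw [subdiv_single]
  refine map_mem_of_mem_supported _ (fun w hw => ?_)
    (sd_pow_single_mem n (fun i => stdSimplex.vertex i) zero_le_one (fun i j => ?_) r)
  · rw [push_single]
    refine Finsupp.single_mem_supported ℤ 1 ?_
    have hsub : ∀ t, aff w t ∈ Metric.ball (w 0) δ := fun t =>
      Metric.mem_ball.2 ((dist_aff_le w hw t).trans_lt hr)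
    obtain ⟨b, hb⟩ := hball (w 0) (mem_univ _)
    cases b
    · exact Or.inr (range_subset_iff.2 fun t => interior_subset (hb (hsub t)))
    · exact Or.inl (range_subset_iff.2 fun t => interior_subset (hb (hsub t)))
  · exact (Metric.dist_le_diam_of_mem (bounded_stdSimplex (Fin (n + 1)))
      (stdSimplex.vertex i).2 (stdSimplex.vertex j).2).trans diam_stdSimplex_le

theorem eventually_subdiv_mem_small {V W : Set Y} (h : interior V ∪ interior W = univ)
    {n : ℕ} (c : Chain n Y) : ∀ᶠ r in atTop, subdiv r n c ∈ small n V W := by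
  have : ∀ᶠ r in atTop, ∀ σ ∈ c.support, subdiv r n (Finsupp.single σ 1) ∈ small n V W :=
    (Filter.eventually_all_finset _).2 fun σ _ => eventually_subdiv_single_mem_small h σ
  filter_upwards [this] with r hr
  exact map_mem_of_mem_supported _ hr (Finsupp.mem_supported _ _ |>.2 Subset.rfl)

/-- The small simplices theorem: modulo small chains, every cycle is a boundary. -/
theorem exists_add_bdry_of_bdry_mem_small {V W : Set Y} (h : interior V ∪ interior W = univ)
    {n : ℕ} (c : Chain (n + 1) Y) (hc : bdry n c ∈ small n V W) :
    ∃ c' ∈ small (n + 1) V W, ∃ e, c = c' + bdry (n + 1) e := by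
  obtain ⟨r, hr⟩ := (eventually_subdiv_mem_small h c).exists
  refine ⟨subdiv r (n + 1) c + subdivHomotopy r n (bdry n c),
    add_mem hr (subdivHomotopy_mem_small r hc), subdivHomotopy r (n + 1) c, ?_⟩
  have := bdry_subdivHomotopy_add r c
  rw [add_assoc, add_comm (subdivHomotopy r n _), this]
  abel

/-- In degree zero every chain is small. -/
theorem mem_small_zero {V W : Set Y} (h : interior V ∪ interior W = univ) (c : Chain 0 Y) :
    c ∈ small 0 V W := by
  refine (Finsupp.mem_supported _ _).2 fun σ _ => ?_
  have hσ : range σ ⊆ {σ default} := range_subset_iff.2 fun t => by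
    rw [Subsingleton.elim t default]; rfl
  have : σ default ∈ interior V ∪ interior W := h ▸ mem_univ _
  rcases this with h | h
  · exact Or.inl (hσ.trans (singleton_subset_iff.2 (interior_subset h)))
  · exact Or.inr (hσ.trans (singleton_subset_iff.2 (interior_subset h)))

end SingularSimplex

/-! ### Comparison of formal sums with the singular chain complex -/

namespace SingularPair

open AlgebraicTopology Simplicial SingularSimplex

variable {Y Z : Type u} [TopologicalSpace Y] [TopologicalSpace Z]

/-- The coefficient module. -/
abbrev coeff : ModuleCat.{u} ℤ := ModuleCat.of ℤ (ULift.{u} ℤ)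

/-- A continuous map from the standard simplex as a simplex of the singular simplicial set. -/
noncomputable def simplex {n : ℕ} (σ : C(stdSimplex ℝ (Fin (n + 1)), Y)) :
    (TopCat.toSSet.obj (TopCat.of Y)) _⦋n⦌ :=
  (TopCat.toSSetObjEquiv (TopCat.of Y) (Opposite.op ⦋n⦌)).symm σ

theorem simplex_surjective {n : ℕ} (x : (TopCat.toSSet.obj (TopCat.of Y)) _⦋n⦌) :
    ∃ σ : C(stdSimplex ℝ (Fin (n + 1)), Y), simplex σ = x :=
  ⟨TopCat.toSSetObjEquiv (TopCat.of Y) (Opposite.op ⦋n⦌) x, Equiv.symm_apply_apply _ _⟩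

/-- The inclusion of the summand of a singular simplex. -/
noncomputable def ι {n : ℕ} (σ : C(stdSimplex ℝ (Fin (n + 1)), Y)) : coeff ⟶ (chains Y).X n :=
  SSet.ιChainComplex (R := coeff) (TopCat.toSSet.obj (TopCat.of Y)) (simplex σ)

theorem ι_d {n : ℕ} (σ : C(stdSimplex ℝ (Fin (n + 2)), Y)) :
    ι σ ≫ (chains Y).d (n + 1) n =
      ∑ i : Fin (n + 2), (-1 : ℤ) ^ (i : ℕ) • ι (σ.comp (faceMap n i)) :=
  SSet.ιChainComplex_d (R := coeff) _ (simplex σ)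

theorem ι_map {n : ℕ} (f : C(Y, Z)) (σ : C(stdSimplex ℝ (Fin (n + 1)), Y)) :
    ι σ ≫ (chainsMap f).f n = ι (f.comp σ) :=
  SSet.ι_chainComplexMap_f _ _ (TopCat.toSSet.map (TopCat.ofHom f)) coeff (simplex σ)

theorem chains_hom_ext {n : ℕ} {T : ModuleCat.{u} ℤ} {f g : (chains Y).X n ⟶ T}
    (h : ∀ σ, ι σ ≫ f = ι σ ≫ g) : f = g := by
  refine (SSet.isColimitChainComplexXCofan (TopCat.toSSet.obj (TopCat.of Y)) coeff n).hom_ext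
    fun ⟨x⟩ => ?_
  obtain ⟨σ, rfl⟩ := simplex_surjective x
  exact h σ

/-- The chain of a formal sum of singular simplices. -/
noncomputable def ofChain (n : ℕ) (Y : Type u) [TopologicalSpace Y] :
    Chain n Y →ₗ[ℤ] (chains Y).X n :=
  Finsupp.linearCombination ℤ fun σ => (ι σ).hom ⟨1⟩

theorem ofChain_single {n : ℕ} (σ : C(stdSimplex ℝ (Fin (n + 1)), Y)) :
    ofChain n Y (Finsupp.single σ 1) = (ι σ).hom ⟨1⟩ :=
  (Finsupp.linearCombination_single ℤ _ _).trans
    (@one_smul ℤ _ _ ((chains Y).X n).isModule.toMulAction _)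

theorem ofChain_bdry {n : ℕ} (c : Chain (n + 1) Y) :
    ofChain n Y (bdry n c) = ((chains Y).d (n + 1) n).hom (ofChain (n + 1) Y c) := by
  refine LinearMap.congr_fun (f := ofChain n Y ∘ₗ bdry n)
    (g := ((chains Y).d (n + 1) n).hom ∘ₗ ofChain (n + 1) Y) ?_ c
  refine Finsupp.lhom_ext' fun σ => LinearMap.ext_ring ?_
  simp only [LinearMap.comp_apply, Finsupp.lsingle_apply, ofChain_single, bdry_single, map_sum,
    map_zsmul]
  have := congrArg (fun f : coeff ⟶ (chains Y).X n => f.hom ⟨1⟩) (ι_d σ)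
  simp only [ModuleCat.hom_comp, LinearMap.comp_apply, ModuleCat.hom_sum, LinearMap.sum_apply,
    ModuleCat.hom_zsmul] at this
  exact this.symm

theorem ofChain_lmapDomain {n : ℕ} (f : C(Y, Z)) (c : Chain n Y) :
    ofChain n Z (Finsupp.lmapDomain ℤ ℤ f.comp c) = ((chainsMap f).f n).hom (ofChain n Y c) := by
  refine LinearMap.congr_fun (f := ofChain n Z ∘ₗ Finsupp.lmapDomain ℤ ℤ f.comp)
    (g := ((chainsMap f).f n).hom ∘ₗ ofChain n Y) ?_ c
  refine Finsupp.lhom_ext' fun σ => LinearMap.ext_ring ?_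
  simp only [LinearMap.comp_apply, Finsupp.lsingle_apply, ofChain_single,
    Finsupp.lmapDomain_apply, Finsupp.mapDomain_single]
  have := congrArg (fun f : coeff ⟶ (chains Z).X n => f.hom ⟨1⟩) (ι_map f σ)
  exact this.symm

theorem ofChain_bijective (n : ℕ) (Y : Type u) [TopologicalSpace Y] :
    Function.Bijective (ofChain n Y) := by
  -- The inverse is supplied by the universal property of the coproduct.
  let p : (chains Y).X n ⟶ ModuleCat.of ℤ (Chain n Y) :=
    (SSet.isColimitChainComplexXCofan (TopCat.toSSet.obj (TopCat.of Y)) coeff n).desc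
      (Cofan.mk _ fun x => ModuleCat.ofHom ((Finsupp.lsingle
        (TopCat.toSSetObjEquiv (TopCat.of Y) (Opposite.op ⦋n⦌) x)) ∘ₗ
          (ULift.moduleEquiv (R := ℤ) (M := ℤ)).toLinearMap))
  have hp : ∀ σ, ι σ ≫ p = ModuleCat.ofHom ((Finsupp.lsingle σ) ∘ₗ
      (ULift.moduleEquiv (R := ℤ) (M := ℤ)).toLinearMap) := by
    intro σ
    refine ((SSet.isColimitChainComplexXCofan (TopCat.toSSet.obj (TopCat.of Y)) coeff n).fac
      _ ⟨simplex σ⟩).trans ?_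
    simp only [Cofan.mk_ι_app]
    congr 3
  have h1 : p.hom ∘ₗ ofChain n Y = LinearMap.id := by
    refine Finsupp.lhom_ext' fun σ => LinearMap.ext_ring ?_
    simp only [LinearMap.comp_apply, Finsupp.lsingle_apply, ofChain_single]
    exact congrArg (fun f : coeff ⟶ ModuleCat.of ℤ (Chain n Y) => f.hom ⟨1⟩) (hp σ)
  have h2 : p ≫ ModuleCat.ofHom (ofChain n Y) = 𝟙 _ := by
    refine chains_hom_ext fun σ => ?_
    rw [← Category.assoc, hp, Category.comp_id]
    ext ⟨a⟩
    change ofChain n Y (Finsupp.single σ a) = (ι σ).hom ⟨a⟩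
    have e1 : Finsupp.single σ a = a • Finsupp.single σ (1 : ℤ) := by simp
    have e2 : (⟨a⟩ : ULift.{u} ℤ) = a • (⟨1⟩ : ULift.{u} ℤ) := by
      apply ULift.ext; simp
    rw [e1, e2, map_zsmul, map_zsmul, ofChain_single]
  refine ⟨fun a b hab => ?_, fun x => ⟨p.hom x, ?_⟩⟩
  · have := congrArg p.hom hab
    rwa [← LinearMap.comp_apply, ← LinearMap.comp_apply, h1] at this
  · exact congrArg (fun f : (chains Y).X n ⟶ (chains Y).X n => f.hom x) h2

end SingularPair

/-! ### Exact sequences of pairs, homotopy invariance and excision -/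

section HomologicalAlgebra

variable {C ι' : Type*} [Category* C] [Abelian C] {c : ComplexShape ι'}
  {S : ShortComplex (HomologicalComplex C c)}

theorem CategoryTheory.ShortComplex.ShortExact.quasiIso_f_of_acyclic (hS : S.ShortExact)
    (h : S.X₃.Acyclic) : _root_.QuasiIso S.f := by
  rw [_root_.quasiIso_iff]
  intro i
  rw [_root_.quasiIsoAt_iff_isIso_homologyMap]
  have hz : ∀ j, IsZero (S.X₃.homology j) := fun j => (h j).isZero_homology
  have : Epi (HomologicalComplex.homologyMap S.f i) :=
    (hS.homology_exact₂ i).epi_f ((hz i).eq_of_tgt _ _)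
  have : Mono (HomologicalComplex.homologyMap S.f i) := by
    by_cases hi : ∃ j, c.Rel j i
    · obtain ⟨j, hj⟩ := hi
      exact (hS.homology_exact₁ j i hj).mono_g ((hz j).eq_of_src _ _)
    · have := hS.mono_f
      exact HomologicalComplex.mono_homologyMap_of_mono_of_not_rel S.f i
        (fun j hj => hi ⟨j, hj⟩)
  exact isIso_of_mono_of_epi _

theorem CategoryTheory.ShortComplex.ShortExact.quasiIso_g_of_acyclic (hS : S.ShortExact)
    (h : S.X₁.Acyclic) : _root_.QuasiIso S.g := by
  rw [_root_.quasiIso_iff]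
  intro i
  rw [_root_.quasiIsoAt_iff_isIso_homologyMap]
  have hz : ∀ j, IsZero (S.X₁.homology j) := fun j => (h j).isZero_homology
  have : Mono (HomologicalComplex.homologyMap S.g i) :=
    (hS.homology_exact₂ i).mono_g ((hz i).eq_of_src _ _)
  have : Epi (HomologicalComplex.homologyMap S.g i) := by
    by_cases hi : ∃ j, c.Rel i j
    · obtain ⟨j, hj⟩ := hi
      exact (hS.homology_exact₃ i j hj).epi_f ((hz j).eq_of_tgt _ _)
    · have := hS.epi_g
      exact HomologicalComplex.epi_homologyMap_of_epi_of_not_rel S.g i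
        (fun j hj => hi ⟨j, hj⟩)
  exact isIso_of_mono_of_epi _

end HomologicalAlgebra

namespace SingularPair

open AlgebraicTopology SingularSimplex

variable {Y Z : Type u} [TopologicalSpace Y] [TopologicalSpace Z]

instance mono_chainsMap_incl (B : Set Y) : Mono (chainsMap (incl B)) := by
  have : Mono (TopCat.ofHom (incl B)) := by
    rw [TopCat.mono_iff_injective]
    exact Subtype.val_injective
  have : chainsFunctor.{u}.PreservesMonomorphisms := by
    delta chainsFunctor
    infer_instance
  exact Functor.map_mono chainsFunctor (TopCat.ofHom (incl B))

/-- The projection from absolute to relative chains. -/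
noncomputable def relπ (B : Set Y) : chains Y ⟶ relChains Y B :=
  cokernel.π (chainsMap (incl B))

instance (B : Set Y) : Epi (relπ B) :=
  inferInstanceAs (Epi (cokernel.π _))

/-- The short exact sequence of singular chain complexes of a pair. -/
noncomputable abbrev pairSequence (B : Set Y) :
    ShortComplex (ChainComplex (ModuleCat.{u} ℤ) ℕ) :=
  ShortComplex.mk (chainsMap (incl B)) (relπ B) (cokernel.condition _)

theorem pairSequence_shortExact (B : Set Y) : (pairSequence B).ShortExact where
  exact := ShortComplex.exact_cokernel _
  mono_f := mono_chainsMap_incl B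
  epi_g := inferInstanceAs (Epi (relπ B))

theorem relπ_surjective (B : Set Y) (n : ℕ) : Function.Surjective ((relπ B).f n).hom := by
  have : Epi ((relπ B).f n) := inferInstance
  exact (ModuleCat.epi_iff_surjective _).1 this

theorem relπ_eq_zero_iff {B : Set Y} {n : ℕ} (x : (chains Y).X n) :
    ((relπ B).f n).hom x = 0 ↔ ∃ b, ((chainsMap (incl B)).f n).hom b = x := by
  have h := (pairSequence_shortExact B).map_of_exact (HomologicalComplex.eval _ _ n)
  refine ⟨fun hx => (ShortComplex.moduleCat_exact_iff _).1 h.exact x hx, ?_⟩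
  rintro ⟨b, rfl⟩
  exact ShortComplex.moduleCat_zero_apply ((pairSequence B).map (HomologicalComplex.eval _ _ n)) b

theorem relπ_relChainsMap {B : Set Y} {D : Set Z} (f : C(Y, Z)) (h : MapsTo f B D) :
    relπ B ≫ relChainsMap f h = chainsMap f ≫ relπ D :=
  cokernel.π_desc _ _ _

theorem relChainsMap_comp {W : Type u} [TopologicalSpace W] {B : Set Y} {D : Set Z} {E : Set W}
    (f : C(Y, Z)) (h : MapsTo f B D) (g : C(Z, W)) (k : MapsTo g D E) :
    relChainsMap f h ≫ relChainsMap g k = relChainsMap (g.comp f) (k.comp h) := by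
  rw [← cancel_epi (relπ B), ← Category.assoc, relπ_relChainsMap, Category.assoc,
    relπ_relChainsMap, relπ_relChainsMap, ← Category.assoc, ← Functor.map_comp]
  rfl

theorem relChainsMap_eq_id {B : Set Y} {f : C(Y, Y)} (hf : f = .id Y) (h : MapsTo f B B) :
    relChainsMap f h = 𝟙 (relChains Y B) := by
  subst hf
  rw [← cancel_epi (relπ B), relπ_relChainsMap, Category.comp_id]
  have : chainsMap (.id Y) = 𝟙 (chains Y) := chainsFunctor.map_id _
  rw [this, Category.id_comp]

/-- The five lemma for pairs of spaces. -/
theorem quasiIso_relChainsMap {B : Set Y} {D : Set Z} (f : C(Y, Z)) (h : MapsTo f B D)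
    (h₁ : QuasiIso (chainsMap (restr f h))) (h₂ : QuasiIso (chainsMap f)) :
    QuasiIso (relChainsMap f h) := by
  let φ : pairSequence B ⟶ pairSequence D :=
    { τ₁ := chainsMap (restr f h)
      τ₂ := chainsMap f
      τ₃ := relChainsMap f h
      comm₁₂ := by
        dsimp only [pairSequence]
        rw [← Functor.map_comp, ← Functor.map_comp]
        rfl
      comm₂₃ := (relπ_relChainsMap f h).symm }
  exact HomologicalComplex.HomologySequence.quasiIso_τ₃ φ (pairSequence_shortExact B)
    (pairSequence_shortExact D) h₁ h₂

theorem homologyMap_chainsMap_eq {f g : C(Y, Z)} (h : f.Homotopic g) (n : ℕ) :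
    HomologicalComplex.homologyMap (chainsMap f) n =
      HomologicalComplex.homologyMap (chainsMap g) n := by
  obtain ⟨H⟩ := h
  exact TopCat.Homotopy.congr_homologyMap_singularChainComplexFunctor
    (f := TopCat.ofHom f) (g := TopCat.ofHom g) H _ n

theorem quasiIso_chainsMap_of_homotopic_id {f : C(Y, Y)} (h : f.Homotopic (.id Y)) :
    QuasiIso (chainsMap f) := by
  rw [quasiIso_iff]
  intro n
  rw [quasiIsoAt_iff_isIso_homologyMap, homologyMap_chainsMap_eq h]
  have : chainsMap (.id Y) = 𝟙 (chains Y) := chainsFunctor.map_id _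
  rw [this]
  infer_instance

/-- If both composites of two chain maps are quasi-isomorphisms, so is each of them. -/
theorem quasiIso_of_comp_of_comp {K L : ChainComplex (ModuleCat.{u} ℤ) ℕ} (f : K ⟶ L) (g : L ⟶ K)
    (h₁ : QuasiIso (f ≫ g)) (h₂ : QuasiIso (g ≫ f)) : QuasiIso f := by
  rw [quasiIso_iff] at *
  intro n
  have h₁ := h₁ n
  have h₂ := h₂ n
  rw [quasiIsoAt_iff_isIso_homologyMap] at *
  rw [HomologicalComplex.homologyMap_comp] at h₁ h₂
  have := mono_of_mono (HomologicalComplex.homologyMap f n) (HomologicalComplex.homologyMap g n)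
  have := epi_of_epi (HomologicalComplex.homologyMap g n) (HomologicalComplex.homologyMap f n)
  exact isIso_of_mono_of_epi _

/-- Homotopy equivalences induce isomorphisms in homology. -/
theorem quasiIso_chainsMap_of_homotopic {f : C(Y, Z)} (g : C(Z, Y))
    (h₁ : (g.comp f).Homotopic (.id Y)) (h₂ : (f.comp g).Homotopic (.id Z)) :
    QuasiIso (chainsMap f) := by
  refine quasiIso_of_comp_of_comp (chainsMap f) (chainsMap g) ?_ ?_
  · rw [← Functor.map_comp]; exact quasiIso_chainsMap_of_homotopic_id h₁
  · rw [← Functor.map_comp]; exact quasiIso_chainsMap_of_homotopic_id h₂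

/-- Mutually inverse maps of pairs. -/
theorem quasiIso_relChainsMap_of_inverse {B : Set Y} {D : Set Z} (f : C(Y, Z)) (h : MapsTo f B D)
    (g : C(Z, Y)) (k : MapsTo g D B) (h₁ : g.comp f = .id Y) (h₂ : f.comp g = .id Z) :
    QuasiIso (relChainsMap f h) := by
  refine quasiIso_of_comp_of_comp _ (relChainsMap g k) ?_ ?_
  · rw [relChainsMap_comp, relChainsMap_eq_id h₁]
    infer_instance
  · rw [relChainsMap_comp, relChainsMap_eq_id h₂]
    infer_instance

theorem comp_incl_injective (V : Set Y) (n : ℕ) :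
    Function.Injective ((incl V).comp : C(stdSimplex ℝ (Fin (n + 1)), V) → C(_, Y)) :=
  fun _ _ h => ContinuousMap.ext fun t => Subtype.ext (DFunLike.congr_fun h t)

/-- A formal sum of simplices contained in `V` comes from a formal sum of simplices of `V`. -/
theorem exists_lmapDomain_incl {V : Set Y} {n : ℕ} {c : Chain n Y}
    (hc : c ∈ Finsupp.supported ℤ ℤ {σ : C(stdSimplex ℝ (Fin (n + 1)), Y) | range σ ⊆ V}) :
    ∃ c' : Chain n V, Finsupp.lmapDomain ℤ ℤ (incl V).comp c' = c := by
  have h : {σ : C(stdSimplex ℝ (Fin (n + 1)), Y) | range σ ⊆ V} ⊆ (incl V).comp '' univ := by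
    intro σ hσ
    refine ⟨⟨fun t => ⟨σ t, hσ (mem_range_self t)⟩, σ.continuous.subtype_mk _⟩, mem_univ _, ?_⟩
    rfl
  have := Finsupp.supported_mono h hc
  rw [← Finsupp.lmapDomain_supported] at this
  obtain ⟨c', -, hc'⟩ := this
  exact ⟨c', hc'⟩

/-- Small chains are sums of a chain of `V` and a chain of `W`. -/
theorem ofChain_mem_small {V W : Set Y} {n : ℕ} {c : Chain n Y} (hc : c ∈ small n V W) :
    ∃ v w, ofChain n Y c = ((chainsMap (incl V)).f n).hom v + ((chainsMap (incl W)).f n).hom w := by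
  have : c ∈ Finsupp.supported ℤ ℤ {σ : C(stdSimplex ℝ (Fin (n + 1)), Y) | range σ ⊆ V} ⊔
      Finsupp.supported ℤ ℤ {σ : C(stdSimplex ℝ (Fin (n + 1)), Y) | range σ ⊆ W} := by
    rw [← Finsupp.supported_union]; exact hc
  obtain ⟨a, ha, b, hb, rfl⟩ := Submodule.mem_sup.1 this
  obtain ⟨a, rfl⟩ := exists_lmapDomain_incl ha
  obtain ⟨b, rfl⟩ := exists_lmapDomain_incl hb
  exact ⟨ofChain n V a, ofChain n W b, by rw [map_add, ofChain_lmapDomain, ofChain_lmapDomain]⟩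

theorem mem_small_of_ofChain_eq {V W : Set Y} {n : ℕ} {c : Chain n Y} {v w}
    (h : ofChain n Y c = ((chainsMap (incl V)).f n).hom v + ((chainsMap (incl W)).f n).hom w) :
    c ∈ small n V W := by
  obtain ⟨a, rfl⟩ := (ofChain_bijective n V).2 v
  obtain ⟨b, rfl⟩ := (ofChain_bijective n W).2 w
  rw [← ofChain_lmapDomain, ← ofChain_lmapDomain, ← map_add] at h
  have hc := (ofChain_bijective n Y).1 h
  have key : ∀ (U : Set Y) (a : Chain n U) (s : Set C(stdSimplex ℝ (Fin (n + 1)), Y)),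
      (∀ σ : C(stdSimplex ℝ (Fin (n + 1)), Y), range σ ⊆ U → σ ∈ s) →
      Finsupp.lmapDomain ℤ ℤ (incl U).comp a ∈ Finsupp.supported ℤ ℤ s := by
    intro U a s hs
    refine VertexChains.map_mem_of_mem_supported _ (s := univ) (fun σ _ => ?_) (by simp)
    rw [Finsupp.lmapDomain_apply, Finsupp.mapDomain_single]
    exact Finsupp.single_mem_supported ℤ 1 (hs _ (range_subset_iff.2 fun t => (σ t).2))
  rw [hc]
  exact add_mem (key V a _ fun _ => Or.inl) (key W b _ fun _ => Or.inr)

theorem mapsTo_incl_preimage (V W : Set Y) :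
    MapsTo (incl V) (Subtype.val ⁻¹' W : Set V) W := fun _ h => h

/-- A chain of `V` that is a chain of `W` when seen in `Y` is a chain of `V ∩ W`. -/
theorem mono_relChainsMap_incl (V W : Set Y) : Mono (relChainsMap (incl V)
    (mapsTo_incl_preimage V W)) := by
  classical
  refine HomologicalComplex.mono_of_mono_f _ fun n => ?_
  rw [ModuleCat.mono_iff_injective]
  refine (injective_iff_map_eq_zero _).2 fun x hx => ?_
  obtain ⟨v, rfl⟩ := relπ_surjective _ n x
  obtain ⟨c, rfl⟩ := (ofChain_bijective n V).2 v
  have e := congrArg (fun f => (f.f n).hom (ofChain n V c))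
    (relπ_relChainsMap (incl V) (mapsTo_incl_preimage V W))
  change ((relChainsMap (incl V) (mapsTo_incl_preimage V W)).f n).hom _ =
    ((relπ W).f n).hom (((chainsMap (incl V)).f n).hom (ofChain n V c)) at e
  have hx' : ((relπ W).f n).hom (((chainsMap (incl V)).f n).hom (ofChain n V c)) = 0 :=
    e.symm.trans hx
  obtain ⟨w, hw⟩ := (relπ_eq_zero_iff _).1 hx'
  have hsmall : Finsupp.lmapDomain ℤ ℤ (incl V).comp c ∈ small n W W := by
    refine mem_small_of_ofChain_eq (v := w) (w := 0) ?_
    rw [ofChain_lmapDomain, map_zero, add_zero, hw]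
  have hc : c ∈ Finsupp.supported ℤ ℤ
      {σ : C(stdSimplex ℝ (Fin (n + 1)), V) | range σ ⊆ Subtype.val ⁻¹' W} := by
    refine (Finsupp.mem_supported _ _).2 fun σ hσ => ?_
    have h2 : (incl V).comp σ ∈ (Finsupp.mapDomain (incl V).comp c).support := by
      rw [Finsupp.mapDomain_support_of_injective (comp_incl_injective V n)]
      exact Finset.mem_image_of_mem _ hσ
    have h3 : range ((incl V).comp σ) ⊆ W := ((Finsupp.mem_supported _ _).1 hsmall h2).elim id id
    exact range_subset_iff.2 fun t => h3 ⟨t, rfl⟩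
  obtain ⟨c', rfl⟩ := exists_lmapDomain_incl hc
  exact (relπ_eq_zero_iff _).2 ⟨ofChain n _ c', by rw [ofChain_lmapDomain]⟩

/-- Excision. The map is injective on chains, and by the small simplices theorem its cokernel, the
quotient of the chains of `Y` by the small chains, is acyclic. -/
theorem quasiIso_relChainsMap_incl {V W : Set Y} (h : interior V ∪ interior W = univ) :
    QuasiIso (relChainsMap (incl V) (mapsTo_incl_preimage V W)) := by
  have := mono_relChainsMap_incl V W
  set φ := relChainsMap (incl V) (mapsTo_incl_preimage V W) with hφ
  have hS : (ShortComplex.mk φ (cokernel.π φ) (cokernel.condition φ)).ShortExact :=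
    { exact := ShortComplex.exact_cokernel φ, mono_f := this, epi_g := inferInstance }
  refine hS.quasiIso_f_of_acyclic fun n => ?_
  have hsurj : ∀ k (q : (cokernel φ).X k), ∃ c : Chain k Y,
      ((cokernel.π φ).f k).hom (((relπ W).f k).hom (ofChain k Y c)) = q := by
    intro k q
    have he : Epi ((cokernel.π φ).f k) := inferInstance
    obtain ⟨y, rfl⟩ := (ModuleCat.epi_iff_surjective _).1 he q
    obtain ⟨z, rfl⟩ := relπ_surjective W k y
    obtain ⟨c, rfl⟩ := (ofChain_bijective k Y).2 z
    exact ⟨c, rfl⟩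
  have hcomm : ∀ k v, ((relπ W).f k).hom (((chainsMap (incl V)).f k).hom v) =
      (φ.f k).hom (((relπ (Subtype.val ⁻¹' W : Set V)).f k).hom v) := fun k v =>
    (congrArg (fun f => (f.f k).hom v)
      (relπ_relChainsMap (incl V) (mapsTo_incl_preimage V W))).symm
  -- The chains that vanish in the cokernel are the small ones.
  have hzero : ∀ k (c : Chain k Y), c ∈ small k V W ↔
      ((cokernel.π φ).f k).hom (((relπ W).f k).hom (ofChain k Y c)) = 0 := by
    intro k c
    have hex := hS.map_of_exact (HomologicalComplex.eval _ _ k)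
    constructor
    · intro hc
      obtain ⟨v, w, hvw⟩ := ofChain_mem_small hc
      rw [hvw, map_add, (relπ_eq_zero_iff _).2 ⟨w, rfl⟩, add_zero, hcomm]
      exact ShortComplex.moduleCat_zero_apply
        ((ShortComplex.mk φ (cokernel.π φ) (cokernel.condition φ)).map
          (HomologicalComplex.eval _ _ k)) _
    · intro hc
      obtain ⟨x, hx⟩ := (ShortComplex.moduleCat_exact_iff _).1 hex.exact _ hc
      obtain ⟨v, rfl⟩ := relπ_surjective _ k x
      have h0 : ((relπ W).f k).hom (ofChain k Y c - ((chainsMap (incl V)).f k).hom v) = 0 := by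
        rw [map_sub, hcomm, sub_eq_zero]
        exact hx.symm
      obtain ⟨w, hw⟩ := (relπ_eq_zero_iff _).1 h0
      exact mem_small_of_ofChain_eq (v := v) (w := w) (by rw [hw]; abel)
  have hd : ∀ k (c : Chain (k + 1) Y), ((cokernel φ).d (k + 1) k).hom
      (((cokernel.π φ).f (k + 1)).hom (((relπ W).f (k + 1)).hom (ofChain (k + 1) Y c))) =
        ((cokernel.π φ).f k).hom (((relπ W).f k).hom (ofChain k Y (bdry k c))) := by
    intro k c
    rw [ofChain_bdry]
    exact congrArg (fun f => f.hom (ofChain (k + 1) Y c))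
      ((relπ W ≫ cokernel.π φ).comm (k + 1) k)
  cases n with
  | zero =>
    refine HomologicalComplex.ExactAt.of_isZero ?_
    rw [ModuleCat.isZero_iff_subsingleton]
    refine subsingleton_of_forall_eq 0 fun q => ?_
    obtain ⟨c, rfl⟩ := hsurj 0 q
    exact (hzero 0 c).1 (mem_small_zero h c)
  | succ n =>
    rw [HomologicalComplex.exactAt_iff' _ (n + 2) (n + 1) n (by simp) (by simp),
      ShortComplex.moduleCat_exact_iff]
    intro q hq
    -- A cycle of the cokernel lifts to a chain of `Y` whose boundary is small.
    obtain ⟨c, rfl⟩ := hsurj (n + 1) q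
    have hc : bdry n c ∈ small n V W := (hzero n _).2 ((hd n c).symm.trans hq)
    obtain ⟨c', hc', e, rfl⟩ := exists_add_bdry_of_bdry_mem_small h c hc
    refine ⟨((cokernel.π φ).f (n + 2)).hom (((relπ W).f (n + 2)).hom (ofChain (n + 2) Y e)), ?_⟩
    refine (hd (n + 1) e).trans ?_
    rw [map_add, map_add, map_add, (hzero _ _).1 hc', zero_add]

end SingularPair

/-! ### Quotient spaces and good pairs -/

namespace SingularPair

open scoped unitInterval

variable {Y Z : Type u} [TopologicalSpace Y] [TopologicalSpace Z] {B : Set Y}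

namespace Collapse

theorem ind {P : Collapse Y B → Prop} (hp : ∀ y, P (proj B y)) (hb : P (base B)) (q) : P q := by
  obtain ⟨y | ⟨⟩, rfl⟩ := Quot.exists_rep q
  exacts [hp y, hb]

/-- A continuous map that is constant on `B` descends to `Y / B`; the value at the base point has to
be given, as `B` may be empty. -/
def lift (f : C(Y, Z)) (z : Z) (h : ∀ y ∈ B, f y = z) : C(Collapse Y B, Z) :=
  ⟨Quot.lift (Sum.elim f fun _ => z) (by rintro _ _ ⟨y, hy, rfl, rfl⟩; exact h y hy),
    continuous_quot_lift _ (f.continuous.sumElim continuous_const)⟩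

/-- A homotopy that is constant on `B` descends to `Y / B`. Continuity holds because the unit
interval is locally compact. -/
def liftHomotopy (F : C(I × Y, Z)) (z : Z) (h : ∀ t, ∀ y ∈ B, F (t, y) = z) :
    C(I × Collapse Y B, Z) :=
  (lift (F.comp ContinuousMap.prodSwap).curry (.const I z)
    fun y hy => ContinuousMap.ext fun t => h t y hy).uncurry.comp ContinuousMap.prodSwap

open Classical in
/-- The point of `Y` outside `B` represented by a point of `Y / B` other than the base point. -/
noncomputable def toOption : Collapse Y B → Option Y :=
  Quot.lift (Sum.elim (fun y => if y ∈ B then none else some y) fun _ => none)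
    (by rintro _ _ ⟨y, hy, rfl, rfl⟩; simp [hy])

theorem proj_eq_base_iff {y : Y} : proj B y = base B ↔ y ∈ B := by
  refine ⟨fun h => ?_, fun h => proj_mapsTo B h⟩
  by_contra hy
  have := congrArg toOption h
  simp [toOption, proj, base, hy] at this

theorem eq_of_proj_eq {y y' : Y} (hy : y ∉ B) (h : proj B y = proj B y') : y = y' := by
  have hy' : y' ∉ B := fun h' => hy (proj_eq_base_iff.1 (h.trans (proj_eq_base_iff.2 h')))
  have := congrArg toOption h
  simpa [toOption, proj, hy, hy'] using this

theorem isOpen_iff {S : Set (Collapse Y B)} : IsOpen S ↔ IsOpen (proj B ⁻¹' S) := by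
  rw [← isQuotientMap_quot_mk.isOpen_preimage, isOpen_sum_iff]
  exact and_iff_left (isOpen_discrete _)

theorem isClosed_base (hB : IsClosed B) : IsClosed {base B} := by
  rw [← isOpen_compl_iff, isOpen_iff]
  convert hB.isOpen_compl using 1
  ext y
  simp [proj_eq_base_iff]

end Collapse

/-- A pointed homotopy equivalence of quotient spaces induces isomorphisms in reduced homology. -/
theorem quasiIso_relChainsMap_collapse {D : Set Z}
    (f : C(Collapse Y B, Collapse Z D)) (hf : MapsTo f {Collapse.base B} {Collapse.base D})
    (g : C(Collapse Z D, Collapse Y B)) (hg : MapsTo g {Collapse.base D} {Collapse.base B})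
    (h₁ : (g.comp f).Homotopic (.id _)) (h₂ : (f.comp g).Homotopic (.id _)) :
    QuasiIso (relChainsMap f hf) := by
  refine quasiIso_relChainsMap f hf ?_ (quasiIso_chainsMap_of_homotopic g h₁ h₂)
  refine quasiIso_chainsMap_of_homotopic (restr g hg) ?_ ?_
  · rw [show (restr g hg).comp (restr f hf) = .id _ from
      ContinuousMap.ext fun _ => Subsingleton.elim _ _]
  · rw [show (restr f hf).comp (restr g hg) = .id _ from
      ContinuousMap.ext fun _ => Subsingleton.elim _ _]

/-- The restriction of a homotopy to an invariant subspace. -/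
def restrictHomotopy (H : C(I × Y, Y)) {D : Set Y} (hD : ∀ t, ∀ y ∈ D, H (t, y) ∈ D)
    (h0 : ∀ y, H (0, y) = y) (g : C(D, D)) (hg : ∀ y : D, (g y : Y) = H (1, y)) :
    ContinuousMap.Homotopy (.id D) g where
  toFun p := ⟨H (p.1, p.2), hD _ _ p.2.2⟩
  continuous_toFun := by fun_prop
  map_zero_left y := Subtype.ext (h0 y)
  map_one_left y := Subtype.ext (hg y).symm

/-- If a closed set `B` has a neighborhood `B'` which is carried into `B` by a deformation of `Y`
that preserves `B` and `B'`, then `(Y, B)` is a good pair: enlarging `B` to `B'` and the base point to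
`B' / B` changes no homology, and excising `B` and the base point leaves homeomorphic pairs. -/
theorem isGood_of_deformation {B' : Set Y} (hB : IsClosed B) (hBB' : B ⊆ interior B')
    (H : C(I × Y, Y)) (h0 : ∀ y, H (0, y) = y) (hHB : ∀ t, ∀ y ∈ B, H (t, y) ∈ B)
    (hHB' : ∀ t, ∀ y ∈ B', H (t, y) ∈ B') (h1 : ∀ y ∈ B', H (1, y) ∈ B) : IsGood Y B := by
  have hsub : B ⊆ B' := hBB'.trans interior_subset
  set D' : Set (Collapse Y B) := Collapse.proj B '' B' ∪ {Collapse.base B} with hD'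
  have hp' : MapsTo (Collapse.proj B) B' D' := fun y hy => Or.inl ⟨y, hy, rfl⟩
  have hm1 : MapsTo (ContinuousMap.id Y) B B' := hsub
  have hm2 : MapsTo (ContinuousMap.id (Collapse Y B)) {Collapse.base B} D' :=
    fun y hy => Or.inr hy
  -- enlarging `B`
  have enlarge : QuasiIso (relChainsMap (.id Y) hm1) := by
    refine quasiIso_relChainsMap _ _ ?_
      (quasiIso_chainsMap_of_homotopic_id (ContinuousMap.Homotopic.refl _))
    let g : C(B', B) := ⟨fun y => ⟨H (1, y), h1 y y.2⟩, by fun_prop⟩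
    refine quasiIso_chainsMap_of_homotopic g ?_ ?_
    · exact ⟨(restrictHomotopy H hHB h0 (g.comp (restr (.id Y) hm1)) fun y => rfl).symm⟩
    · exact ⟨(restrictHomotopy H hHB' h0 ((restr (.id Y) hm1).comp g) fun y => rfl).symm⟩
  -- enlarging the base point
  have enlargeBase : QuasiIso (relChainsMap (.id (Collapse Y B)) hm2) := by
    refine quasiIso_relChainsMap _ _ ?_
      (quasiIso_chainsMap_of_homotopic_id (ContinuousMap.Homotopic.refl _))
    let K : C(I × Collapse Y B, Collapse Y B) :=
      Collapse.liftHomotopy ((Collapse.proj B).comp H) (Collapse.base B)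
        fun t y hy => Collapse.proj_mapsTo B (hHB t y hy)
    have hK : ∀ t, ∀ q ∈ D', K (t, q) ∈ D' := by
      rintro t _ (⟨y, hy, rfl⟩ | rfl)
      · exact hp' (hHB' t y hy)
      · exact Or.inr rfl
    have hK0 : ∀ q, K (0, q) = q := by
      refine Collapse.ind (fun y => ?_) rfl
      change Collapse.proj B (H (0, y)) = _
      rw [h0]
    have hK1 : ∀ q ∈ D', K (1, q) = Collapse.base B := by
      rintro _ (⟨y, hy, rfl⟩ | rfl)
      · exact Collapse.proj_mapsTo B (h1 y hy)
      · rfl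
    let g : C(D', ({Collapse.base B} : Set (Collapse Y B))) := .const _ ⟨_, rfl⟩
    refine quasiIso_chainsMap_of_homotopic g ?_ ?_
    · rw [show g.comp (restr (.id (Collapse Y B)) hm2) = .id _ from
        ContinuousMap.ext fun _ => Subsingleton.elim _ _]
    · exact ⟨(restrictHomotopy K hK hK0 ((restr (.id (Collapse Y B)) hm2).comp g)
        fun q => (hK1 q q.2).symm).symm⟩
  -- excision in `Y` and in `Y / B`
  have excise := quasiIso_relChainsMap_incl (V := Bᶜ) (W := B') (by
    rw [hB.isOpen_compl.interior_eq, eq_univ_iff_forall]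
    intro y
    exact (em (y ∈ B)).symm.imp id fun h => hBB' h)
  have hopen : IsOpen ({Collapse.base B}ᶜ : Set (Collapse Y B)) :=
    (Collapse.isClosed_base hB).isOpen_compl
  have exciseBase := quasiIso_relChainsMap_incl (V := {Collapse.base B}ᶜ) (W := D') (by
    rw [hopen.interior_eq, eq_univ_iff_forall]
    intro q
    refine (em (q = Collapse.base B)).symm.imp id ?_
    rintro rfl
    refine mem_interior.2 ⟨Collapse.proj B '' interior B' ∪ {Collapse.base B},
      union_subset_union_left _ (image_mono interior_subset), ?_, Or.inr rfl⟩
    rw [Collapse.isOpen_iff]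
    convert isOpen_interior (s := B') using 1
    ext y
    constructor
    · rintro (⟨y', hy', h⟩ | h)
      · by_cases hyB : y ∈ B
        · exact hBB' hyB
        · rwa [Collapse.eq_of_proj_eq hyB h.symm]
      · exact hBB' (Collapse.proj_eq_base_iff.1 h)
    · exact fun hy => Or.inl ⟨y, hy, rfl⟩)
  -- off `B` and the base point the projection is a homeomorphism
  have hmc : MapsTo (Collapse.proj B) Bᶜ {Collapse.base B}ᶜ :=
    fun y hy h => hy (Collapse.proj_eq_base_iff.1 h)
  let p : C((Bᶜ : Set Y), ({Collapse.base B}ᶜ : Set (Collapse Y B))) := restr (Collapse.proj B) hmc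
  have hp : IsHomeomorph p := by
    refine ⟨p.continuous, ?_, ?_, ?_⟩
    · rintro _ ⟨O, hO, rfl⟩
      refine ⟨Collapse.proj B '' (O ∩ Bᶜ), ?_, ?_⟩
      · rw [Collapse.isOpen_iff]
        convert hO.inter hB.isOpen_compl using 1
        ext y
        constructor
        · rintro ⟨y', hy', h⟩
          rwa [← Collapse.eq_of_proj_eq hy'.2 h]
        · exact fun hy => ⟨y, hy, rfl⟩
      · ext ⟨q, hq⟩
        constructor
        · rintro ⟨y, hy, rfl⟩
          exact ⟨⟨y, hy.2⟩, hy.1, rfl⟩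
        · rintro ⟨y, hy, h⟩
          exact ⟨y, ⟨hy, y.2⟩, congrArg Subtype.val h⟩
    · intro y y' h
      exact Subtype.ext (Collapse.eq_of_proj_eq y.2 (congrArg Subtype.val h))
    · rintro ⟨q, hq⟩
      induction q using Collapse.ind with
      | hp y => exact ⟨⟨y, fun h => hq (Collapse.proj_eq_base_iff.2 h)⟩, rfl⟩
      | hb => exact absurd rfl hq
  have hpm : MapsTo p (Subtype.val ⁻¹' B') (Subtype.val ⁻¹' D') := fun y hy => hp' hy
  have homeo : QuasiIso (relChainsMap p hpm) := by
    let e := hp.homeomorph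
    refine quasiIso_relChainsMap_of_inverse p hpm ⟨e.symm, e.symm.continuous⟩ ?_ ?_ ?_
    · intro q hq
      obtain ⟨y, rfl⟩ := e.surjective q
      change ((e.symm (e y) : (Bᶜ : Set Y)) : Y) ∈ B'
      rw [e.symm_apply_apply]
      rcases hq with ⟨y', hy', h⟩ | h
      · rwa [Collapse.eq_of_proj_eq y.2 h.symm]
      · exact absurd (Collapse.proj_eq_base_iff.1 h) y.2
    · exact ContinuousMap.ext e.symm_apply_apply
    · exact ContinuousMap.ext e.apply_symm_apply
  have projNhd : QuasiIso (relChainsMap (Collapse.proj B) hp') := by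
    have hc : relChainsMap (incl Bᶜ) (mapsTo_incl_preimage Bᶜ B') ≫
        relChainsMap (Collapse.proj B) hp' = relChainsMap p hpm ≫
          relChainsMap (incl {Collapse.base B}ᶜ) (mapsTo_incl_preimage _ D') := by
      rw [relChainsMap_comp, relChainsMap_comp]
      rfl
    have : QuasiIso (relChainsMap (incl Bᶜ) (mapsTo_incl_preimage Bᶜ B') ≫
        relChainsMap (Collapse.proj B) hp') := by
      rw [hc]; infer_instance
    exact quasiIso_of_comp_left (relChainsMap (incl Bᶜ) (mapsTo_incl_preimage Bᶜ B')) _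
  have projPair : QuasiIso (relChainsMap (Collapse.proj B) (Collapse.proj_mapsTo B)) := by
    have hc : relChainsMap (Collapse.proj B) (Collapse.proj_mapsTo B) ≫
        relChainsMap (.id (Collapse Y B)) hm2 =
          relChainsMap (.id Y) hm1 ≫ relChainsMap (Collapse.proj B) hp' := by
      rw [relChainsMap_comp, relChainsMap_comp]
      rfl
    have : QuasiIso (relChainsMap (Collapse.proj B) (Collapse.proj_mapsTo B) ≫
        relChainsMap (.id (Collapse Y B)) hm2) := by
      rw [hc]; infer_instance
    exact quasiIso_of_comp_right _ (relChainsMap (.id (Collapse Y B)) hm2)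
  intro n
  rw [← quasiIsoAt_iff_isIso_homologyMap]
  infer_instance

/-- The pair `(Y, ∅)` is good. -/
theorem isGood_empty (Y : Type u) [TopologicalSpace Y] : IsGood Y (∅ : Set Y) :=
  isGood_of_deformation (B' := ∅) isClosed_empty (empty_subset _) ContinuousMap.snd
    (fun _ => rfl) (fun _ _ h => h) (fun _ _ h => h) (fun _ h => h)

/-! ### Relative homology in special cases -/

theorem acyclic_chains_of_isEmpty (Y : Type u) [TopologicalSpace Y] [IsEmpty Y] :
    (chains Y).Acyclic := by
  intro n
  refine HomologicalComplex.ExactAt.of_isZero ((IsZero.iff_id_eq_zero _).2 ?_)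
  exact chains_hom_ext fun s => isEmptyElim (s stdSimplex.barycenter)

/-- The homology of `(Y, B)` with `B` empty is the homology of `Y`. -/
theorem quasiIso_relπ_of_eq_empty (hB : B = ∅) : QuasiIso (relπ B) := by
  have : IsEmpty B := isEmpty_coe_sort.2 hB
  exact (pairSequence_shortExact B).quasiIso_g_of_acyclic (acyclic_chains_of_isEmpty B)

/-- If `H_•(Y, B) = 0` then the inclusion of `B` induces isomorphisms in homology. -/
theorem quasiIso_incl_of_isZero (h : ∀ n, IsZero (relHomology Y B n)) :
    QuasiIso (chainsMap (incl B)) :=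
  (pairSequence_shortExact B).quasiIso_f_of_acyclic fun n =>
    ((relChains Y B).exactAt_iff_isZero_homology n).2 (h n)

end SingularPair

/-! ### The Conley index does not depend on the index pair -/

namespace ConleyTheory

open SingularPair
open scoped unitInterval

variable {X : Type u} [TopologicalSpace X]

/-- The orbit of `x` stays in `P` during the time interval `[a, b]`. -/
def Stays (φ : Flow ℝ≥0 X) (P : Set X) (a b : ℝ≥0) (x : X) : Prop :=
  ∀ r, a ≤ r → r ≤ b → φ r x ∈ P

namespace Stays

variable {φ : Flow ℝ≥0 X} {P Q : Set X} {a b c d : ℝ≥0} {x : X}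

theorem mono (h : Stays φ P a b x) (hPQ : P ⊆ Q) (hac : a ≤ c) (hdb : d ≤ b) :
    Stays φ Q c d x :=
  fun r h1 h2 => hPQ (h r (hac.trans h1) (h2.trans hdb))

theorem trans (h : Stays φ P a b x) (h' : Stays φ P b c x) : Stays φ P a c x := fun r h1 h2 =>
  (le_total r b).elim (h r h1) fun hr => h' r hr h2

theorem shift_iff {s : ℝ≥0} : Stays φ P a b (φ s x) ↔ Stays φ P (a + s) (b + s) x := by
  constructor
  · intro h r h1 h2
    obtain ⟨r, rfl⟩ := exists_add_of_le (le_add_self.trans h1)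
    rw [add_comm s r] at *
    rw [φ.map_add]
    exact h r (le_of_add_le_add_right h1) (le_of_add_le_add_right h2)
  · intro h r h1 h2
    rw [← φ.map_add]
    exact h _ (add_le_add_left h1 s) (add_le_add_left h2 s)

end Stays

/-- Staying in a closed set during a time interval that depends continuously on a parameter is a
closed condition. The interval is parametrized proportionally by `[0, 1]`. -/
theorem isClosed_stays (φ : Flow ℝ≥0 X) {P : Set X} (hP : IsClosed P) (a : ℝ≥0) {E : Type*}
    [TopologicalSpace E] {t : E → ℝ≥0} (ht : Continuous t) {f : E → X} (hf : Continuous f) :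
    IsClosed {e | Stays φ P a (a + t e) (f e)} := by
  have : {e | Stays φ P a (a + t e) (f e)} =
      ⋂ s : Icc (0 : ℝ≥0) 1, {e | φ (a + s * t e) (f e) ∈ P} := by
    ext e
    simp only [mem_ofPred_eq, mem_iInter]
    constructor
    · intro h s
      refine h _ le_self_add ?_
      gcongr
      exact mul_le_of_le_one_left' s.2.2
    · intro h r h1 h2
      obtain ⟨r, rfl⟩ := exists_add_of_le h1
      have h2 : r ≤ t e := le_of_add_le_add_left h2
      by_cases h0 : t e = 0
      · have : r = 0 := le_antisymm (h0 ▸ h2) zero_le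
        have h3 := h ⟨0, le_rfl, zero_le_one⟩
        simpa [this] using h3
      · have h3 := h ⟨r / t e, zero_le, div_le_one_of_le₀ h2 zero_le⟩
        rwa [div_mul_cancel₀ _ h0] at h3
  rw [this]
  refine isClosed_iInter fun s => hP.preimage ?_
  fun_prop

/-- Staying in an open set during a compact time interval is an open condition: the complementary
condition is the projection of a closed set along the compact factor `[0, 1]`. -/
theorem isOpen_stays (φ : Flow ℝ≥0 X) {P : Set X} (hP : IsOpen P) {E : Type*}
    [TopologicalSpace E] {t : E → ℝ≥0} (ht : Continuous t) {f : E → X} (hf : Continuous f) :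
    IsOpen {e | Stays φ P 0 (t e) (f e)} := by
  rw [← isClosed_compl_iff]
  let C : Set (Icc (0 : ℝ≥0) 1 × E) := {p | φ (p.1 * t p.2) (f p.2) ∈ Pᶜ}
  have hC : IsClosed C := hP.isClosed_compl.preimage (by fun_prop)
  convert isClosedMap_snd_of_compactSpace C hC using 1
  ext e
  simp only [mem_compl_iff, mem_ofPred_eq, Stays, mem_image, Prod.exists, exists_eq_right, C]
  constructor
  · intro h
    push Not at h
    obtain ⟨r, -, h2, h3⟩ := h
    by_cases h0 : t e = 0
    · have : r = 0 := le_antisymm (h0 ▸ h2) zero_le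
      exact ⟨⟨0, le_rfl, zero_le_one⟩, by simpa [this] using h3⟩
    · refine ⟨⟨r / t e, zero_le, div_le_one_of_le₀ h2 zero_le⟩, ?_⟩
      simpa [div_mul_cancel₀ _ h0] using h3
  · rintro ⟨s, hs⟩ h
    exact hs (h _ zero_le (mul_le_of_le_one_left' s.2.2))

/-- Orbits that stay in a closed set `K` for a long time are, in the middle of that time, near the
maximal invariant subset of `K`: a limit of such midpoints has a full orbit in `K`. -/
theorem exists_forall_stays_mem [CompactSpace X] [T2Space X] (φ : Flow ℝ≥0 X) {K O : Set X}
    (hK : IsClosed K) (hO : IsOpen O) (h : maxInvariant φ K ⊆ O) :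
    ∃ T₀, ∀ T ≥ T₀, ∀ x, Stays φ K 0 (2 * T) x → φ T x ∈ O := by
  by_contra! hcon
  choose T hT x hx hxO using fun n : ℕ => hcon n
  let U : Ultrafilter ℕ := hyperfilter ℕ
  have hU : (U : Filter ℕ) ≤ atTop := by
    rw [← Nat.cofinite_eq_atTop]; exact hyperfilter_le_cofinite
  have hTU : Tendsto T U atTop :=
    (tendsto_atTop_mono hT tendsto_natCast_atTop_atTop).mono_left hU
  -- `y s` is the point at time `-s` on the limit of the orbits, with time `0` at the midpoints.
  have hy : ∀ s : ℝ≥0, ∃ y, Tendsto (fun n => φ (T n - s) (x n)) U (𝓝 y) := by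
    intro s
    obtain ⟨y, -, hy⟩ := isCompact_univ.ultrafilter_le_nhds
      (U.map fun n => φ (T n - s) (x n)) (by simp)
    exact ⟨y, hy⟩
  choose y hy using hy
  have hflow : ∀ t s, Tendsto (fun n => φ (t + (T n - s)) (x n)) U (𝓝 (φ t (y s))) := by
    intro t s
    simp only [φ.map_add]
    exact ((φ.continuous_toFun t).tendsto _).comp (hy s)
  have hback : ∀ a s, φ a (y (s + a)) = y s := by
    intro a s
    refine tendsto_nhds_unique (hflow a (s + a)) ((hy s).congr' ?_)
    filter_upwards [hTU.eventually_ge_atTop (s + a)] with n hn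
    congr 1
    rw [← tsub_tsub, add_tsub_cancel_of_le (le_tsub_of_add_le_left hn)]
  have hinv : {z | ∃ t s, z = φ t (y s)} ⊆ K ∧ IsInvariantSet φ {z | ∃ t s, z = φ t (y s)} := by
    refine ⟨?_, fun a => Subset.antisymm ?_ ?_⟩
    · rintro _ ⟨t, s, rfl⟩
      refine hK.mem_of_tendsto (hflow t s) ?_
      filter_upwards [hTU.eventually_ge_atTop t] with n hn
      refine hx n _ zero_le ?_
      rw [two_mul]
      exact add_le_add hn tsub_le_self
    · rintro _ ⟨_, ⟨t, s, rfl⟩, rfl⟩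
      exact ⟨a + t, s, (φ.map_add _ _ _).symm⟩
    · rintro _ ⟨t, s, rfl⟩
      refine ⟨φ t (y (s + a)), ⟨t, _, rfl⟩, ?_⟩
      rw [← φ.map_add, add_comm, φ.map_add, hback]
  have h0 : y 0 ∈ O := h (mem_sUnion.2 ⟨_, hinv, 0, 0, by simp⟩)
  have h1 : ∀ᶠ n in (U : Filter ℕ), φ (T n - 0) (x n) ∈ O := (hy 0).eventually_mem (hO.mem_nhds h0)
  obtain ⟨n, hn⟩ := h1.exists
  exact hxO n (by simpa using hn)

open Classical in
/-- The class in `N / L` of a point of `X`; points outside `N` are sent to the base point. -/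
noncomputable def cls (N L : Set X) (z : X) : Collapse N (Subtype.val ⁻¹' L) :=
  if h : z ∈ N then Collapse.proj _ ⟨z, h⟩ else Collapse.base _

theorem cls_of_mem {N L : Set X} {z : X} (h : z ∈ N) :
    cls N L z = Collapse.proj (Subtype.val ⁻¹' L) ⟨z, h⟩ := dif_pos h

theorem cls_eq_base {N L : Set X} {z : X} (h : z ∈ L) : cls N L z = Collapse.base _ := by
  by_cases hN : z ∈ N
  · rw [cls_of_mem hN]; exact Collapse.proj_mapsTo _ h
  · exact dif_neg hN

theorem continuousOn_cls (N L : Set X) : ContinuousOn (cls N L) N := by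
  rw [continuousOn_iff_continuous_domRestrict]
  exact (Collapse.proj (Subtype.val ⁻¹' L : Set N)).continuous.congr fun z => (cls_of_mem z.2).symm

open Classical in
/-- A map that is defined on an open set `O` and tends to the exit set `L` at the boundary of `O`
extends continuously, by the base point, as a map to `N / L`. -/
theorem continuous_ite_cls {N L : Set X} {E : Type*} [TopologicalSpace E] {O : Set E}
    (hO : IsOpen O) {h : E → X} (hh : Continuous h) (hN : ∀ e ∈ closure O, h e ∈ N)
    (hL : ∀ e ∈ closure O, e ∉ O → h e ∈ L) :
    Continuous fun e => if e ∈ O then cls N L (h e) else Collapse.base _ := by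
  refine continuous_if (fun e he => ?_) ?_ continuousOn_const
  · rw [show {e | e ∈ O} = O from rfl, hO.frontier_eq] at he
    exact cls_eq_base (hL e he.1 he.2)
  · exact (continuousOn_cls N L).comp hh.continuousOn hN

namespace IsIndexPair

variable {φ : Flow ℝ≥0 X} {S N L N' L' : Set X}

/-- A point of `N` cannot leave `N \ L` without hitting `L`. -/
theorem stays_diff_iff (h : IsIndexPair φ S N L) {x : X} (hx : x ∈ N) {t : ℝ≥0} :
    Stays φ (N \ L) 0 t x ↔ Stays φ Lᶜ 0 t x := by
  refine ⟨fun H => H.mono (fun _ => And.right) le_rfl le_rfl, fun H r h0 hr => ⟨?_, H r h0 hr⟩⟩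
  by_contra hr'
  have hpos : 0 < r := by
    rw [pos_iff_ne_zero]
    rintro rfl
    exact hr' (by simpa using hx)
  obtain ⟨t₀, ht₀, -, ht₀L⟩ := h.exitSet x hx r hpos hr'
  exact H t₀ zero_le (ht₀.2.trans hr) ht₀L

/-- An orbit that stays in `N` and hits `L` is in `L` from then on. -/
theorem mem_of_stays (h : IsIndexPair φ S N L) {x : X} {t : ℝ≥0} (H : Stays φ N 0 t x)
    (H' : ¬ Stays φ Lᶜ 0 t x) : φ t x ∈ L := by
  simp only [Stays] at H'
  push Not at H'
  obtain ⟨r, -, hrt, hr⟩ := H'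
  obtain ⟨s, rfl⟩ := exists_add_of_le hrt
  rw [add_comm r s, φ.map_add]
  refine h.positivelyInvariant _ (not_not.1 hr) s (fun q hq => ?_) s ⟨zero_le, le_rfl⟩
  rw [← φ.map_add]
  refine H _ zero_le ?_
  rw [add_comm q r]
  exact add_le_add_right hq.2 r

theorem not_stays_of_mem {t : ℝ≥0} {x : X} (hx : x ∈ L) : ¬ Stays φ (N \ L) 0 t x := fun H =>
  (H 0 le_rfl zero_le).2 (by simpa using hx)

/-- An orbit that stays in `N \ L` is in `N' \ L'` except near the ends of the time interval. -/
theorem stays_of_stays {P Q : Set X} {T : ℝ≥0}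
    (hT : ∀ x, Stays φ (closure P) 0 (2 * T) x → φ T x ∈ interior Q) {a b : ℝ≥0} {x : X}
    (H : Stays φ P a (b + T) x) : Stays φ Q (a + T) b x := by
  intro r h1 h2
  obtain ⟨s, rfl⟩ := exists_add_of_le (le_add_self.trans h1)
  rw [φ.map_add]
  refine interior_subset (hT _ (Stays.shift_iff.2 (H.mono subset_closure ?_ ?_)))
  · rw [zero_add]
    rw [add_comm] at h1
    exact le_of_add_le_add_left h1
  · rw [two_mul, add_right_comm]
    exact add_le_add_left (by rwa [add_comm] at h2 ⊢) T

variable [T2Space X]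

/-- For two index pairs of the same set, an orbit that stays in `N \ L` for a long time is in the
interior of `N' \ L'` in the middle of that time. -/
theorem exists_time [CompactSpace X] (h : IsIndexPair φ S N L) (h' : IsIndexPair φ S N' L') :
    ∃ T₀, ∀ T ≥ T₀, ∀ x, Stays φ (closure (N \ L)) 0 (2 * T) x → φ T x ∈ interior (N' \ L') := by
  refine exists_forall_stays_mem φ isClosed_closure isOpen_interior ?_
  rw [← h.eq_maxInvariant]
  exact subset_interior_iff_mem_nhdsSet.2 h'.mem_nhdsSet

theorem closure_diff_subset (h : IsIndexPair φ S N L) : closure (N \ L) ⊆ N :=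
  closure_minimal sdiff_subset h.isCompact_left.isClosed

variable (φ N L N' L') in
/-- The points whose orbit stays in `N \ L` during `[0, 2T]` and in `N' \ L'` during `[T, 3T]`. -/
def transfer (T : ℝ≥0) : Set X :=
  {x | Stays φ (N \ L) 0 (2 * T) x ∧ Stays φ (N' \ L') T (T + 2 * T) x}

open Classical in
variable (φ N L N' L') in
/-- The comparison of the quotients of two index pairs: follow the orbit of `x ∈ N` during time `3T`,
unless it leaves `N \ L` before `2T` or fails to be in `N' \ L'` after `T`. -/
noncomputable def transferFun (T : ℝ≥0) (x : N) : Collapse N' (Subtype.val ⁻¹' L') :=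
  if (x : X) ∈ transfer φ N L N' L' T then cls N' L' (φ (T + 2 * T) x) else Collapse.base _

/-- The set of points that are not sent to the base point is open, and at its boundary the orbit
arrives in `L'`. -/
theorem continuous_transferFun (h : IsIndexPair φ S N L) (h' : IsIndexPair φ S N' L') {T : ℝ≥0}
    (hT : ∀ x, Stays φ (closure (N \ L)) 0 (2 * T) x → φ T x ∈ interior (N' \ L'))
    (hT' : ∀ x, Stays φ (closure (N' \ L')) 0 (2 * T) x → φ T x ∈ interior (N \ L)) :
    Continuous (transferFun φ N L N' L' T) := by
  have hopen : {x : N | (x : X) ∈ transfer φ N L N' L' T} =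
      {x : N | Stays φ Lᶜ 0 (2 * T) (x : X)} ∩ {x : N | φ T (x : X) ∈ interior (N' \ L')} ∩
        {x : N | Stays φ L'ᶜ 0 (2 * T) (φ T (x : X))} := by
    ext x
    constructor
    · rintro ⟨h1, h2⟩
      have h3 : φ T (x : X) ∈ interior (N' \ L') := hT x (h1.mono subset_closure le_rfl le_rfl)
      refine ⟨⟨(h.stays_diff_iff x.2).1 h1, h3⟩, ?_⟩
      refine (h'.stays_diff_iff (interior_subset h3).1).1 (Stays.shift_iff.2 ?_)
      rwa [zero_add, add_comm]
    · rintro ⟨⟨h1, h2⟩, h3⟩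
      refine ⟨(h.stays_diff_iff x.2).2 h1, ?_⟩
      have := Stays.shift_iff.1 ((h'.stays_diff_iff (interior_subset h2).1).2 h3)
      rwa [zero_add, add_comm] at this
  have hclosure : ∀ x ∈ closure {x : N | (x : X) ∈ transfer φ N L N' L' T},
      Stays φ (closure (N \ L)) 0 (0 + 2 * T) (x : X) ∧
        Stays φ (closure (N' \ L')) T (T + 2 * T) (x : X) := by
    refine fun x hx => closure_minimal (t := {x : N | _ ∧ _}) ?_ (IsClosed.inter
      (isClosed_stays φ isClosed_closure 0 (continuous_const (y := 2 * T)) continuous_subtype_val)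
      (isClosed_stays φ isClosed_closure T (continuous_const (y := 2 * T))
        continuous_subtype_val)) hx
    rintro x ⟨h1, h2⟩
    exact ⟨h1.mono subset_closure le_rfl (by simp), h2.mono subset_closure le_rfl le_rfl⟩
  refine continuous_ite_cls (O := {x : N | (x : X) ∈ transfer φ N L N' L' T}) ?_ (by fun_prop)
    (fun x hx => ?_) (fun x hx hx' => ?_)
  · rw [hopen]
    refine ((isOpen_stays φ h.isCompact_right.isClosed.isOpen_compl continuous_const
      continuous_subtype_val).inter (isOpen_interior.preimage (by fun_prop))).inter
      (isOpen_stays φ h'.isCompact_right.isClosed.isOpen_compl continuous_const (by fun_prop))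
  · exact h'.closure_diff_subset ((hclosure x hx).2 _ le_self_add le_rfl)
  · obtain ⟨h1, h2⟩ := hclosure x hx
    rw [zero_add] at h1
    have h2' : Stays φ (closure (N' \ L')) 0 (2 * T) (φ T (x : X)) := by
      rw [Stays.shift_iff, zero_add, add_comm]; exact h2
    -- At time `2T` the orbit is in the interior of `N \ L`, so it has not met `L` before.
    have h3 : Stays φ Lᶜ 0 (2 * T) (x : X) := by
      by_contra hcon
      have hL := h.mem_of_stays (h1.mono h.closure_diff_subset le_rfl le_rfl) hcon
      have := hT' _ h2'
      rw [← φ.map_add, ← two_mul] at this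
      exact (interior_subset this).2 hL
    have h4 : ¬ Stays φ L'ᶜ 0 (2 * T) (φ T (x : X)) := fun h4 => hx' (by
      rw [hopen]; exact ⟨⟨h3, hT _ h1⟩, h4⟩)
    have := h'.mem_of_stays (h2'.mono h'.closure_diff_subset le_rfl le_rfl) h4
    rwa [← φ.map_add, add_comm] at this

open Classical in
variable (φ N L) in
/-- The flow induced on `N / L`: orbits that meet `L` are sent to the base point. -/
noncomputable def quotientFlow (t : ℝ≥0) (x : N) : Collapse N (Subtype.val ⁻¹' L) :=
  if Stays φ (N \ L) 0 t x then cls N L (φ t x) else Collapse.base _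

theorem continuous_quotientFlow (h : IsIndexPair φ S N L) {E : Type*} [TopologicalSpace E]
    {t : E → ℝ≥0} (ht : Continuous t) {x : E → N} (hx : Continuous x) :
    Continuous fun e => quotientFlow φ N L (t e) (x e) := by
  have hopen : {e | Stays φ (N \ L) 0 (t e) (x e)} = {e | Stays φ Lᶜ 0 (t e) (x e)} := by
    ext e
    exact h.stays_diff_iff (x e).2
  have hx' : Continuous fun e => (x e : X) := by fun_prop
  have hclosure : ∀ e ∈ closure {e | Stays φ (N \ L) 0 (t e) (x e)},
      Stays φ N 0 (0 + t e) (x e) := fun e he => by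
    refine closure_minimal (t := {e | Stays φ N 0 (0 + t e) (x e)}) ?_
      (isClosed_stays φ h.isCompact_left.isClosed 0 ht hx') he
    exact fun e he => Stays.mono he sdiff_subset le_rfl (by simp)
  refine continuous_ite_cls (O := {e | Stays φ (N \ L) 0 (t e) (x e)}) ?_ (by fun_prop)
    (fun e he => hclosure e he _ zero_le (by simp)) (fun e he he' => ?_)
  · rw [hopen]
    exact isOpen_stays φ h.isCompact_right.isClosed.isOpen_compl ht hx'
  · have := hclosure e he
    rw [zero_add] at this
    exact h.mem_of_stays this fun h' => he' (by rw [hopen]; exact h')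

/-- The comparison map of the quotients of two index pairs. -/
noncomputable def transferMap (h : IsIndexPair φ S N L) (h' : IsIndexPair φ S N' L') {T : ℝ≥0}
    (hT : ∀ x, Stays φ (closure (N \ L)) 0 (2 * T) x → φ T x ∈ interior (N' \ L'))
    (hT' : ∀ x, Stays φ (closure (N' \ L')) 0 (2 * T) x → φ T x ∈ interior (N \ L)) :
    C(Collapse N (Subtype.val ⁻¹' L), Collapse N' (Subtype.val ⁻¹' L')) :=
  Collapse.lift ⟨transferFun φ N L N' L' T, continuous_transferFun h h' hT hT'⟩
    (Collapse.base _) fun x hx => if_neg fun H => not_stays_of_mem (x := (x : X)) hx H.1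

/-- The comparison maps compose to the flow at time `6T`. -/
theorem transferMap_transferFun (h : IsIndexPair φ S N L) (h' : IsIndexPair φ S N' L') {T : ℝ≥0}
    (hT : ∀ x, Stays φ (closure (N \ L)) 0 (2 * T) x → φ T x ∈ interior (N' \ L'))
    (hT' : ∀ x, Stays φ (closure (N' \ L')) 0 (2 * T) x → φ T x ∈ interior (N \ L)) (x : N) :
    transferMap h' h hT' hT (transferFun φ N L N' L' T x) =
      quotientFlow φ N L (T + 2 * T + (T + 2 * T)) x := by
  have hpos := NNReal.coe_nonneg T
  -- Staying in `N \ L` up to time `6T` implies staying in `N' \ L'` from `T` to `5T`.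
  have hmid : Stays φ (N \ L) 0 (T + 2 * T + (T + 2 * T)) (x : X) →
      Stays φ (N' \ L') T (T + 2 * T + 2 * T) (x : X) := by
    intro H
    have := stays_of_stays hT (a := 0) (b := T + 2 * T + 2 * T)
      (H.mono Subset.rfl le_rfl (le_of_eq (by ring)))
    rwa [zero_add] at this
  by_cases hx : (x : X) ∈ transfer φ N L N' L' T
  · have hmem : φ (T + 2 * T) (x : X) ∈ N' := (hx.2 _ le_self_add le_rfl).1
    have e1 : transferFun φ N L N' L' T x = Collapse.proj _ ⟨φ (T + 2 * T) (x : X), hmem⟩ := by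
      rw [transferFun, if_pos hx, cls_of_mem hmem]
    rw [e1]
    change transferFun φ N' L' N L T ⟨φ (T + 2 * T) (x : X), hmem⟩ = _
    have key : φ (T + 2 * T) (x : X) ∈ transfer φ N' L' N L T ↔
        Stays φ (N \ L) 0 (T + 2 * T + (T + 2 * T)) x := by
      rw [transfer, mem_ofPred_eq, Stays.shift_iff, Stays.shift_iff]
      constructor
      · rintro ⟨H1, H2⟩
        have h1 : Stays φ (N' \ L') T (T + 2 * T + T + T) (x : X) :=
          hx.2.trans (H1.mono Subset.rfl (by simp) (le_of_eq (by ring)))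
        have h2 := stays_of_stays hT' h1
        exact ((hx.1.mono Subset.rfl le_rfl (le_of_eq (by ring))).trans h2).trans
          (H2.mono Subset.rfl (le_of_eq (by ring)) le_rfl)
      · intro H
        exact ⟨(hmid H).mono Subset.rfl (by simp) (le_of_eq (by ring)),
          H.mono Subset.rfl zero_le le_rfl⟩
    rw [transferFun, quotientFlow, φ.map_add (T + 2 * T) (T + 2 * T)]
    by_cases hk : Stays φ (N \ L) 0 (T + 2 * T + (T + 2 * T)) (x : X)
    · rw [if_pos hk, if_pos (key.2 hk)]
    · rw [if_neg hk, if_neg (mt key.1 hk)]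
  · have e1 : transferFun φ N L N' L' T x = Collapse.base _ := if_neg hx
    rw [e1, quotientFlow, if_neg]
    · rfl
    · intro H
      refine hx ⟨H.mono Subset.rfl le_rfl ?_, (hmid H).mono Subset.rfl le_rfl le_self_add⟩
      rw [← NNReal.coe_le_coe]
      push_cast
      linarith

/-- The comparison maps in both directions are homotopy inverse to each other: their composite is the
flow on `N / L` at a positive time, which is deformed to the identity by shortening the time. -/
theorem transferMap_comp_homotopic (h : IsIndexPair φ S N L) (h' : IsIndexPair φ S N' L')
    {T : ℝ≥0} (hT : ∀ x, Stays φ (closure (N \ L)) 0 (2 * T) x → φ T x ∈ interior (N' \ L'))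
    (hT' : ∀ x, Stays φ (closure (N' \ L')) 0 (2 * T) x → φ T x ∈ interior (N \ L)) :
    ((transferMap h' h hT' hT).comp (transferMap h h' hT hT')).Homotopic (.id _) := by
  let F : C(I × N, Collapse N (Subtype.val ⁻¹' L)) :=
    ⟨fun p => quotientFlow φ N L (Real.toNNReal p.1 * (T + 2 * T + (T + 2 * T))) p.2,
      h.continuous_quotientFlow (by fun_prop) continuous_snd⟩
  let K := Collapse.liftHomotopy F (Collapse.base _)
    fun t x hx => if_neg (not_stays_of_mem (x := (x : X)) hx)
  refine ContinuousMap.Homotopic.symm ⟨⟨K, ?_, ?_⟩⟩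
  · refine Collapse.ind (fun x => ?_) rfl
    change quotientFlow φ N L (Real.toNNReal 0 * _) x = Collapse.proj _ x
    rw [Real.toNNReal_zero, zero_mul, quotientFlow]
    by_cases hx : (x : X) ∈ L
    · rw [if_neg (not_stays_of_mem hx)]
      exact (Collapse.proj_mapsTo (Subtype.val ⁻¹' L : Set N) (show x ∈ _ from hx)).symm
    · rw [if_pos, φ.map_zero_apply, cls_of_mem x.2]
      intro r _ hr
      obtain rfl : r = 0 := le_antisymm hr zero_le
      rw [φ.map_zero_apply]
      exact ⟨x.2, hx⟩
  · refine Collapse.ind (fun x => ?_) rfl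
    change quotientFlow φ N L (Real.toNNReal 1 * _) x =
      transferMap h' h hT' hT (transferFun φ N L N' L' T x)
    rw [Real.toNNReal_one, one_mul, transferMap_transferFun]

/-- The reduced homology of `N / L` is the same for all index pairs of an invariant set. -/
theorem exists_quasiIso [CompactSpace X] (h : IsIndexPair φ S N L)
    (h' : IsIndexPair φ S N' L') :
    ∃ (f : C(Collapse N (Subtype.val ⁻¹' L), Collapse N' (Subtype.val ⁻¹' L')))
      (hf : MapsTo f {Collapse.base _} {Collapse.base _}), QuasiIso (relChainsMap f hf) := by
  obtain ⟨T₁, hT₁⟩ := h.exists_time h'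
  obtain ⟨T₂, hT₂⟩ := h'.exists_time h
  have hT := hT₁ (max T₁ T₂) (le_max_left _ _)
  have hT' := hT₂ (max T₁ T₂) (le_max_right _ _)
  refine ⟨transferMap h h' hT hT', ?_, ?_⟩
  · rintro _ rfl; rfl
  · refine quasiIso_relChainsMap_collapse _ _ (transferMap h' h hT' hT) ?_
      (transferMap_comp_homotopic h h' hT hT') (transferMap_comp_homotopic h' h hT' hT)
    rintro _ rfl; rfl

end IsIndexPair

/-- The Conley index does not depend on the good index pair. -/
theorem IsGoodIndexPair.nonempty_iso [CompactSpace X] [T2Space X] {φ : Flow ℝ≥0 X}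
    {S N L N' L' : Set X} (h : IsGoodIndexPair φ S N L) (h' : IsGoodIndexPair φ S N' L') (n : ℕ) :
    Nonempty (conleyHomology N L n ≅ conleyHomology N' L' n) := by
  obtain ⟨f, hf, hq⟩ := h.toIsIndexPair.exists_quasiIso h'.toIsIndexPair
  have h₁ : IsIso (HomologicalComplex.homologyMap (relChainsMap (Collapse.proj _)
    (Collapse.proj_mapsTo (Subtype.val ⁻¹' L : Set N))) n) := h.isGood n
  have h₂ : IsIso (HomologicalComplex.homologyMap (relChainsMap (Collapse.proj _)
    (Collapse.proj_mapsTo (Subtype.val ⁻¹' L' : Set N'))) n) := h'.isGood n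
  exact ⟨@asIso _ _ _ _ _ h₁ ≪≫ asIso (HomologicalComplex.homologyMap (relChainsMap f hf) n) ≪≫
    (@asIso _ _ _ _ _ h₂).symm⟩

end ConleyTheory

/-! ### Attractor blocks -/

namespace ConleyTheory

open SingularPair
open scoped unitInterval

variable {X : Type u} [TopologicalSpace X] {φ : Flow ℝ≥0 X} {A K K' S U : Set X}

theorem isInvariantSet_maxInvariant (φ : Flow ℝ≥0 X) (K : Set X) :
    IsInvariantSet φ (maxInvariant φ K) := by
  intro t
  rw [maxInvariant, image_sUnion]
  refine Subset.antisymm (sUnion_subset ?_) (sUnion_subset fun S hS => ?_)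
  · rintro _ ⟨S, hS, rfl⟩
    rw [hS.2 t]
    exact subset_sUnion_of_mem hS
  · exact subset_sUnion_of_mem ⟨S, hS, hS.2 t⟩

theorem IsInvariantSet.mem (hS : IsInvariantSet φ S) {x : X} (hx : x ∈ S) (t : ℝ≥0) :
    φ t x ∈ S :=
  hS t ▸ mem_image_of_mem _ hx

theorem IsInvariantSet.subset_omegaLimit (hS : IsInvariantSet φ S) (hU : S ⊆ U) :
    S ⊆ omegaLimit atTop φ U := by
  refine fun x hx => mem_iInter₂.2 fun u hu => ?_
  obtain ⟨t, ht⟩ := (Filter.nonempty_of_mem hu)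
  obtain ⟨y, hy, rfl⟩ : x ∈ φ t '' S := (hS t).symm ▸ hx
  exact subset_closure ⟨t, ht, y, hU hy, rfl⟩

theorem IsInvariantSet.omegaLimit_subset (hS : IsInvariantSet φ S) {x : X} (hx : x ∈ S) :
    omegaLimit atTop φ {x} ⊆ closure S := by
  refine (omegaLimit_subset_closure_image2 _ _ _ univ_mem).trans (closure_mono ?_)
  rintro _ ⟨t, -, y, rfl, rfl⟩
  exact hS.mem hx t

/-- The points whose whole orbit lies in `K`. For a closed neighborhood `K` of an attractor, within
a neighborhood that it attracts, this is a positively invariant neighborhood of the attractor. -/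
def block (φ : Flow ℝ≥0 X) (K : Set X) : Set X :=
  {x | ∀ t, φ t x ∈ K}

theorem block_subset : block φ K ⊆ K := fun x hx => by simpa using hx 0

theorem block_mono (h : K ⊆ K') : block φ K ⊆ block φ K' := fun _ hx t => h (hx t)

theorem flow_mem_block {x : X} (hx : x ∈ block φ K) (t : ℝ≥0) : φ t x ∈ block φ K := fun s => by
  rw [← φ.map_add]; exact hx _

theorem isClosed_block (hK : IsClosed K) : IsClosed (block φ K) := by
  have : block φ K = ⋂ t, φ t ⁻¹' K := by ext; simp [block]
  rw [this]
  exact isClosed_iInter fun t => hK.preimage (φ.continuous_toFun t)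

/-- If `φ t` maps `K` into its interior for `t ≥ T`, only the orbits up to time `T` matter. -/
theorem block_subset_interior_block {T : ℝ≥0} (hT : ∀ t ≥ T, MapsTo (φ t) K (interior K))
    (h : S ⊆ block φ (interior K)) : S ⊆ interior (block φ K) := by
  refine h.trans (Subset.trans (?_ : _ ⊆ {x | Stays φ (interior K) 0 T x}) ?_)
  · exact fun x hx r _ _ => hx r
  · refine interior_maximal (fun x hx t => ?_)
      (isOpen_stays φ isOpen_interior continuous_const continuous_id)
    rcases le_total t T with ht | ht
    · exact interior_subset (hx t zero_le ht)
    · refine interior_subset (hT t ht (interior_subset ?_))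
      simpa using hx 0 le_rfl zero_le

/-- An attractor block, with empty exit set, isolates the attractor. -/
theorem isIndexPair_block_empty [CompactSpace X] (hA : IsInvariantSet φ A)
    (hU : omegaLimit atTop φ U = A) (hK : IsClosed K) (hKU : K ⊆ U)
    (hAK : A ⊆ interior (block φ K)) : IsIndexPair φ A (block φ K) ∅ where
  isCompact_left := (isClosed_block hK).isCompact
  isCompact_right := isCompact_empty
  subset := empty_subset _
  eq_maxInvariant := by
    rw [sdiff_empty, (isClosed_block hK).closure_eq]
    refine Subset.antisymm (subset_sUnion_of_mem ⟨hAK.trans interior_subset, hA⟩) ?_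
    refine sUnion_subset fun S hS => ?_
    rw [← hU]
    exact hS.2.subset_omegaLimit (hS.1.trans (block_subset.trans hKU))
  mem_nhdsSet := by
    rw [sdiff_empty]
    exact subset_interior_iff_mem_nhdsSet.1 hAK
  positivelyInvariant := fun x hx => hx.elim
  exitSet := fun x hx t₁ _ h => absurd (flow_mem_block hx t₁) h

/-- Every orbit leaves the complement of an attractor block through the block, and the invariant sets
in the closure of this complement are those in the dual repeller. -/
theorem isIndexPair_univ_block [CompactSpace X] [T2Space X]
    (hU : omegaLimit atTop φ U = A) (hK : IsClosed K) (hKU : K ⊆ U)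
    (hAK : A ⊆ interior (block φ K)) :
    IsIndexPair φ (maxInvariant φ (dualRepeller φ A)) univ (block φ K) := by
  have hdisj : ∀ x ∈ dualRepeller φ A, x ∉ block φ K := by
    intro x hx hxK
    obtain ⟨y, hy⟩ := nonempty_omegaLimit atTop φ {x} (singleton_nonempty x)
    have hyA : y ∈ A := hU ▸ omegaLimit_mono_right _ _
      (singleton_subset_iff.2 (hKU (block_subset hxK))) hy
    exact (hx.subset ⟨hy, hyA⟩ : y ∈ (∅ : Set X))
  exact
  { isCompact_left := isCompact_univ
    isCompact_right := (isClosed_block hK).isCompact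
    subset := subset_univ _
    eq_maxInvariant := by
      rw [← compl_eq_univ_sdiff]
      refine congrArg sUnion (Set.ext fun S => ?_)
      change (S ⊆ _ ∧ _) ↔ (S ⊆ _ ∧ _)
      refine and_congr_left fun hS => ⟨fun h x hx => subset_closure (hdisj x (h hx)), ?_⟩
      intro h x hx
      refine eq_empty_iff_forall_notMem.2 fun y hy => ?_
      have := closure_minimal h isClosed_closure (hS.omegaLimit_subset hx hy.1)
      rw [closure_compl] at this
      exact this (hAK hy.2)
    mem_nhdsSet := by
      rw [← compl_eq_univ_sdiff]
      refine (isClosed_block hK).isOpen_compl.mem_nhdsSet.2 (sUnion_subset fun S hS x hx => ?_)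
      exact hdisj x (hS.1 hx)
    positivelyInvariant := fun x hx t _ s _ => flow_mem_block hx s
    exitSet := fun x _ t₁ _ h => absurd (mem_univ _) h }

theorem isIndexPair_univ_empty [CompactSpace X] :
    IsIndexPair φ (maxInvariant φ univ) univ ∅ where
  isCompact_left := isCompact_univ
  isCompact_right := isCompact_empty
  subset := empty_subset _
  eq_maxInvariant := by rw [sdiff_empty, closure_univ]
  mem_nhdsSet := by rw [sdiff_empty]; exact univ_mem
  positivelyInvariant := fun x hx => hx.elim
  exitSet := fun x _ t₁ _ h => absurd (mem_univ _) h

/-- If the flow at time `T` pushes a larger block into a smaller one, the smaller one is the subspace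
of a good pair: the flow is the required deformation. -/
theorem isGood_univ_block {T : ℝ≥0} (hK : IsClosed K)
    (hint : block φ K ⊆ interior (block φ K')) (hT : ∀ t ≥ T, MapsTo (φ t) K' K) :
    IsGood (univ : Set X) (Subtype.val ⁻¹' block φ K) := by
  let H : C(I × (univ : Set X), (univ : Set X)) :=
    ⟨fun p => ⟨φ (Real.toNNReal p.1 * T) p.2, mem_univ _⟩, by fun_prop⟩
  refine isGood_of_deformation (B' := Subtype.val ⁻¹' block φ K')
    ((isClosed_block hK).preimage continuous_subtype_val) ?_ H ?_ ?_ ?_ ?_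
  · exact (preimage_mono hint).trans (preimage_interior_subset_interior_preimage
      continuous_subtype_val)
  · exact fun y => Subtype.ext (by simp [H])
  · exact fun t y hy => flow_mem_block hy _
  · exact fun t y hy => flow_mem_block hy _
  · intro y hy t
    change φ t (φ (Real.toNNReal 1 * T) y) ∈ K
    rw [Real.toNNReal_one, one_mul, ← φ.map_add]
    exact hT _ le_add_self (block_subset hy)

/-- Every attractor has an attractor block `N` such that `(N, ∅)` and `(X, N)` are good index pairs
for the attractor and for the invariant part of its dual repeller. -/
theorem IsAttractor.exists_block [CompactSpace X] [T2Space X] (hA : IsAttractor φ A)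
    (hinv : IsInvariantSet φ A) : ∃ N, IsGoodIndexPair φ A N ∅ ∧
      IsGoodIndexPair φ (maxInvariant φ (dualRepeller φ A)) univ N := by
  obtain ⟨U, hUA, hU⟩ := hA
  have hAcl : IsClosed A := hU ▸ isClosed_omegaLimit _ _ _
  obtain ⟨V', hV', hAV', hV'U⟩ := normal_exists_closure_subset hAcl isOpen_interior
    (subset_interior_iff_mem_nhdsSet.2 hUA)
  obtain ⟨V, hV, hAV, hVV'⟩ := normal_exists_closure_subset hAcl hV' hAV'
  have hK'U : closure V' ⊆ U := hV'U.trans interior_subset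
  have hKK' : closure V ⊆ closure V' := hVV'.trans subset_closure
  obtain ⟨T, hT⟩ := eventually_atTop.1 (eventually_mapsTo_of_isOpen_of_omegaLimit_subset
    atTop φ U hV (hU.subset.trans hAV))
  have hVK : V ⊆ interior (closure V) := hV.subset_interior_closure
  have hVK' : closure V ⊆ interior (closure V') := hVV'.trans hV'.subset_interior_closure
  have hT1 : ∀ t ≥ T, MapsTo (φ t) (closure V) (interior (closure V)) := fun t ht x hx =>
    hVK (hT t ht (hK'U (hKK' hx)))
  have hT2 : ∀ t ≥ T, MapsTo (φ t) (closure V') (interior (closure V')) := fun t ht x hx =>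
    hVK' (subset_closure (hT t ht (hK'U hx)))
  have hAK : A ⊆ interior (block φ (closure V)) :=
    block_subset_interior_block hT1 fun x hx t => hVK (hAV (hinv.mem hx t))
  have hKint : block φ (closure V) ⊆ interior (block φ (closure V')) :=
    block_subset_interior_block hT2 (block_mono hVK')
  -- The block of the smaller neighborhood works; that of the larger one makes it a good pair.
  refine ⟨block φ (closure V), ⟨?_, ?_⟩, ⟨?_, ?_⟩⟩
  · exact isIndexPair_block_empty hinv hU isClosed_closure (hKK'.trans hK'U) hAK
  · rw [preimage_empty]; exact isGood_empty _
  · exact isIndexPair_univ_block hU isClosed_closure (hKK'.trans hK'U) hAK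
  · exact isGood_univ_block isClosed_closure hKint fun t ht x hx =>
      subset_closure (hT t ht (hK'U hx))

theorem isGoodIndexPair_univ_empty [CompactSpace X] :
    IsGoodIndexPair φ (maxInvariant φ univ) univ ∅ :=
  ⟨isIndexPair_univ_empty, by rw [preimage_empty]; exact isGood_empty _⟩

/-- `H_n(N, ∅) = H_n(N)`. -/
theorem nonempty_conleyHomology_empty_iso (N : Set X) (n : ℕ) :
    Nonempty ((chains N).homology n ≅ conleyHomology N ∅ n) := by
  have := quasiIso_relπ_of_eq_empty (B := (Subtype.val ⁻¹' (∅ : Set X) : Set N)) preimage_empty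
  have h : IsIso (HomologicalComplex.homologyMap
    (relπ (Subtype.val ⁻¹' (∅ : Set X) : Set N)) n) := inferInstance
  exact ⟨@asIso _ _ _ _ _ h⟩

/-- If `H_•(X, N) = 0`, then `H_n(N, ∅) ≅ H_n(X, ∅)`. -/
theorem nonempty_conleyHomology_iso_of_isZero (N : Set X)
    (h : ∀ n, IsZero (conleyHomology univ N n)) (n : ℕ) :
    Nonempty (conleyHomology N ∅ n ≅ conleyHomology (univ : Set X) ∅ n) := by
  have h₁ := quasiIso_incl_of_isZero h
  let f : C(N, (Subtype.val ⁻¹' N : Set (univ : Set X))) :=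
    ⟨fun x => ⟨⟨x, mem_univ _⟩, x.2⟩, by fun_prop⟩
  let g : C((Subtype.val ⁻¹' N : Set (univ : Set X)), N) := ⟨fun x => ⟨x, x.2⟩, by fun_prop⟩
  have h₂ : QuasiIso (chainsMap f) := quasiIso_chainsMap_of_homotopic g
    (ContinuousMap.Homotopic.refl _) (ContinuousMap.Homotopic.refl _)
  obtain ⟨e₁⟩ := nonempty_conleyHomology_empty_iso N n
  obtain ⟨e₂⟩ := nonempty_conleyHomology_empty_iso (univ : Set X) n
  exact ⟨e₁.symm ≪≫ asIso (HomologicalComplex.homologyMap (chainsMap f) n) ≪≫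
    asIso (HomologicalComplex.homologyMap (chainsMap (incl _)) n) ≪≫ e₂⟩

end ConleyTheory

theorem mainTheorem5 {X : Type u} [MetricSpace X] [CompactSpace X] (φ : Flow ℝ≥0 X)
    (A R : Set X) (hA : ConleyTheory.IsAttractor φ A) (hR : R = ConleyTheory.dualRepeller φ A)
    (NA LA NR LR NX LX : Set X)
    (hNA : ConleyTheory.IsGoodIndexPair φ A NA LA)
    (hNR : ConleyTheory.IsGoodIndexPair φ (ConleyTheory.maxInvariant φ R) NR LR)
    (hNX : ConleyTheory.IsGoodIndexPair φ (ConleyTheory.maxInvariant φ Set.univ) NX LX)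
    (hzero : ∀ n : ℕ, IsZero (ConleyTheory.conleyHomology NR LR n)) :
    ∀ n : ℕ, Nonempty
      (ConleyTheory.conleyHomology NA LA n ≅ ConleyTheory.conleyHomology NX LX n) := by
  intro n
  subst hR
  -- `A` is invariant since it has an index pair.
  have hinv : ConleyTheory.IsInvariantSet φ A := by
    rw [hNA.eq_maxInvariant]
    exact ConleyTheory.isInvariantSet_maxInvariant φ _
  obtain ⟨N, hN, hXN⟩ := hA.exists_block hinv
  have hz : ∀ k, IsZero (ConleyTheory.conleyHomology univ N k) := fun k =>
    (hzero k).of_iso (hXN.nonempty_iso hNR k).some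
  obtain ⟨e₁⟩ := hNA.nonempty_iso hN n
  obtain ⟨e₂⟩ := ConleyTheory.nonempty_conleyHomology_iso_of_isZero N hz n
  obtain ⟨e₃⟩ := ConleyTheory.isGoodIndexPair_univ_empty.nonempty_iso hNX n
  exact ⟨e₁ ≪≫ e₂ ≪≫ e₃⟩
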